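/- A \emph{tree} is a planar rooted tree $T$, finite or infinite, all of whose vertices have finite degree $\sigma(v)$ and whose root has degree $1$; $\mathcal T$ is the set of trees, $|T|$ the number of edges, $D_r(T)$ the set of vertices at distance $r$ from the root, $B_r(T)$ the subtree spanned by the vertices at distance at most $r$ from the root, and $h(T)$ the height (with $h(T)=\infty$ if $T$ is infinite). $\mathcal T$ carries the metric $\mathrm{dist}(T,T')=\inf\{1/r : r\in\{1,2,\dots\},\ B_r(T)=B_r(T')\}$ and its Borel $\sigma$-algebra; $\mathcal B_{1/r}(T)$ is the closed ball of radius $1/r$ around $T$. A tree is \emph{one-sided} if its leftmost path $\omega_T$ (the maximal path from the root in which every vertex after the root is the leftmost offspring of its predecessor) has length $h(T)$. Let $\Omega_N$ be the set of one-sided trees with $N$ edges, $\Omega_\infty$ the set of infinite one-sided trees, and $B_{m,N}$ the number of trees of height $m$ in $\Omega_N$. For $\mu\in\mathbb R$ put $W_N^{(\mu)}=\sum_{m\ge1}e^{-\mu m}B_{m,N}$, and let $\tau_N^{(\mu)}$ (for $N\ge 1$) be the probability measure on $\mathcal T$ that gives mass $e^{-\mu h(T)}/W_N^{(\mu)}$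 to each $T\in\Omega_N$. Let $g_c(\mu)$ be the radius of convergence of $\sum_N W_N^{(\mu)}g^N$ and let $X(g)=\sum_{T\text{ finite}}g^{|T|}$. \textbf{Proposition.} Let $\mu<\mu_0=-\ln 2$ and $$p(n)=X(g_c(\mu))^n\bigl(1-X(g_c(\mu))\bigr)=e^{\mu n}(1-e^{\mu}),\qquad n=0,1,2,\dots,$$ where the two expressions agree. Then $p$ is a subcritical offspring distribution, i.e. a probability distribution with mean less than $1$. As $N\to\infty$ the measures $\tau_N^{(\mu)}$ converge weakly to a (unique) Borel probability measure $\tau^{(\mu)}$ on $\mathcal T$, and $\tau^{(\mu)}$ equals the two-type (special/normal) BGW measure $\hat\lambda$ with offspring law $p$. Here $\hat\lambda$ is the unique Borel probability measure on $\mathcal T$ that is concentrated on $\Omega_\infty$ and satisfies $$\hat\lambda(\mathcal B_{1/r}(T))=\prod_{s=1}^{r-1}\Bigl(\prod_{v\in D_s(T)\setminus\{w_s\}}p(\sigma(v)-1)\Bigr)\,p(\sigma(w_s)-2)$$ for all $T\in\Omega_\infty$ and $r\ge1$, where $w_s$ is the leftmost vertex of $D_s(T)$: the special individuals are the vertices of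 $\omega_T$, a special individual other than the root has $n\ge 1$ offspring with probability $p(n-1)$, of which exactly the first is special, and a normal individual has $n\ge0$ offspring, all normal, with probability $p(n)$. Hence, for $\tau^{(\mu)}$-almost every $T$: $T\in\Omega_\infty$; the vertices with infinitely many descendants are exactly those of $\omega_T$ (a single spine), and $\omega_T$ is the only infinite simple path that starts at the root; and all the branches $T_s$, $s\ge1$, are finite, where $T_s$ is the tree consisting of the root edge $(w_{s-1},w_s)$, the offspring of $w_s$ other than the leftmost one, and all the descendants of these. Under $\tau^{(\mu)}$ the branches $T_1,T_2,\dots$ are independent and all distributed according to the one-type BGW measure $\lambda$ with offspring law $p$, the unique Borel probability measure on $\mathcal T$ with $\lambda(\mathcal B_{1/r}(T))=\prod_{s=1}^{r-1}\prod_{v\in D_s(T)}p(\sigma(v)-1)$ for all $T\in\mathcal T$ and $r\ge1$. -/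

import Mathlib

open MeasureTheory Filter Topology

/-- A planar rooted tree, locally finite, with root of degree one, finite or infinite, in the
Ulam–Harris–Neveu encoding: a vertex is the word of the birth ranks (counted from the left,
starting with `0`) on the path from the root to it. The root is the empty word, its only
neighbour is `[0]`, the offspring of `u` are the words `u ++ [i]`, and the distance of a vertex
from the root is the length of the word. Two planar rooted trees are isomorphic if and only if
they have the same encoding. -/
@[ext]
structure PlanarTree where
  /-- the vertex set -/
  verts : Set (List ℕ)
  nil_mem : [] ∈ verts
  root_degree : ∀ i : ℕ, [i] ∈ verts ↔ i = 0
  parent_mem : ∀ (u : List ℕ) (i : ℕ), u ++ [i] ∈ verts → u ∈ verts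
  left_mem : ∀ (u : List ℕ) (i j : ℕ), u ++ [i] ∈ verts → j ≤ i → u ++ [j] ∈ verts
  finite_offspring : ∀ u : List ℕ, {i : ℕ | u ++ [i] ∈ verts}.Finite

namespace PlanarTree

/-- The subtree `B_r(T)` spanned by the vertices at distance at most `r` from the root. -/
def trunc (T : PlanarTree) (r : ℕ) : Set (List ℕ) := {v | v ∈ T.verts ∧ v.length ≤ r}

theorem trunc_mono {T T' : PlanarTree} {r s : ℕ} (h : T.trunc r = T'.trunc r) (hs : s ≤ r) :
    T.trunc s = T'.trunc s := by
  ext v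
  have hv := Set.ext_iff.1 h v
  simp only [trunc, Set.mem_ofPred_eq] at hv ⊢
  constructor
  · rintro ⟨h1, h2⟩
    exact ⟨(hv.1 ⟨h1, h2.trans hs⟩).1, h2⟩
  · rintro ⟨h1, h2⟩
    exact ⟨(hv.2 ⟨h1, h2.trans hs⟩).1, h2⟩

theorem trunc_one (T T' : PlanarTree) : T.trunc 1 = T'.trunc 1 := by
  ext v
  match v with
  | [] => simp [trunc, T.nil_mem, T'.nil_mem]
  | [i] => simp [trunc, T.root_degree, T'.root_degree]
  | i :: j :: w => simp [trunc]

/-- The numbers `1 / r`, where `r ≥ 1` and `B_r(T) = B_r(T')`. -/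
def agreement (T T' : PlanarTree) : Set ℝ :=
  {x | ∃ r : ℕ, 1 ≤ r ∧ T.trunc r = T'.trunc r ∧ x = 1 / (r : ℝ)}

theorem agreement_nonempty (T T' : PlanarTree) : (agreement T T').Nonempty :=
  ⟨1 / ((1 : ℕ) : ℝ), 1, le_rfl, trunc_one T T', rfl⟩

theorem agreement_bddBelow (T T' : PlanarTree) : BddBelow (agreement T T') :=
  ⟨0, by rintro x ⟨r, -, -, rfl⟩; positivity⟩

/-- `dist(T, T') = inf {1 / r | r ≥ 1, B_r(T) = B_r(T')}`. -/
noncomputable instance : MetricSpace PlanarTree where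
  dist T T' := sInf (agreement T T')
  dist_self T := by
    apply le_antisymm
    · refine le_of_forall_pos_le_add fun ε hε => ?_
      obtain ⟨n, hn⟩ := exists_nat_one_div_lt hε
      have : sInf (agreement T T) ≤ 1 / ((n + 1 : ℕ) : ℝ) :=
        csInf_le (agreement_bddBelow T T) ⟨n + 1, by omega, rfl, rfl⟩
      push_cast at this
      linarith
    · exact Real.sInf_nonneg (by rintro x ⟨r, -, -, rfl⟩; positivity)
  dist_comm T T' := by
    have : agreement T T' = agreement T' T := by
      ext x
      simp only [agreement, Set.mem_ofPred_eq, eq_comm]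
    show sInf (agreement T T') = sInf (agreement T' T)
    rw [this]
  dist_triangle T U V := by
    show sInf (agreement T V) ≤ sInf (agreement T U) + sInf (agreement U V)
    have key : ∀ x ∈ agreement T U, ∀ y ∈ agreement U V, sInf (agreement T V) ≤ x + y := by
      rintro x ⟨r, hr, hr', rfl⟩ y ⟨s, hs, hs', rfl⟩
      have hr0 : (0 : ℝ) ≤ 1 / (r : ℝ) := by positivity
      have hs0 : (0 : ℝ) ≤ 1 / (s : ℝ) := by positivity
      rcases le_total r s with h | h
      · have := csInf_le (agreement_bddBelow T V)
          ⟨r, hr, hr'.trans (trunc_mono hs' h), rfl⟩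
        linarith
      · have := csInf_le (agreement_bddBelow T V)
          ⟨s, hs, (trunc_mono hr' h).trans hs', rfl⟩
        linarith
    have h1 : ∀ x ∈ agreement T U, sInf (agreement T V) - x ≤ sInf (agreement U V) :=
      fun x hx => le_csInf (agreement_nonempty U V) fun y hy => by linarith [key x hx y hy]
    have h2 : sInf (agreement T V) - sInf (agreement U V) ≤ sInf (agreement T U) :=
      le_csInf (agreement_nonempty T U) fun x hx => by linarith [h1 x hx]
    linarith
  eq_of_dist_eq_zero {T T'} h := by
    change sInf (agreement T T') = 0 at h
    have hall : ∀ r : ℕ, T.trunc r = T'.trunc r := by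
      intro r
      obtain ⟨x, ⟨s, hs, hs', rfl⟩, hlt⟩ := exists_lt_of_csInf_lt (agreement_nonempty T T')
        (show sInf (agreement T T') < 1 / ((r : ℝ) + 1) by rw [h]; positivity)
      have hs0 : (0 : ℝ) < s := by exact_mod_cast hs
      have : (r : ℝ) + 1 < s := (one_div_lt_one_div hs0 (by positivity)).1 hlt
      have : r + 1 < s := by exact_mod_cast this
      exact trunc_mono hs' (by omega)
    ext v
    have hv := Set.ext_iff.1 (hall v.length) v
    simpa [trunc] using hv

noncomputable instance : MeasurableSpace PlanarTree := borel PlanarTree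

instance : BorelSpace PlanarTree := ⟨rfl⟩

theorem finite_level (T : PlanarTree) (s : ℕ) : {v | v ∈ T.verts ∧ v.length = s}.Finite := by
  induction s with
  | zero =>
    refine (Set.finite_singleton []).subset ?_
    rintro v ⟨-, hv⟩
    exact List.length_eq_zero_iff.1 hv
  | succ s ih =>
    refine (ih.biUnion fun u _ => (T.finite_offspring u).image fun i => u ++ [i]).subset ?_
    rintro v ⟨hv, hl⟩
    have hne : v ≠ [] := by rintro rfl; simp at hl
    have hd := List.dropLast_append_getLast hne
    simp only [Set.mem_iUnion]
    refine ⟨v.dropLast, ⟨T.parent_mem _ (v.getLast hne) (by rwa [hd]), by simp [hl]⟩,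
      v.getLast hne, ?_, hd⟩
    show v.dropLast ++ [v.getLast hne] ∈ T.verts
    rwa [hd]

/-- The set `D_s(T)` of vertices at distance `s` from the root. -/
noncomputable def level (T : PlanarTree) (s : ℕ) : Finset (List ℕ) := (T.finite_level s).toFinset

/-- The number of offspring of `u`, which is `σ(u) - 1` for a vertex `u` different from the root,
where `σ(u)` is the degree. -/
noncomputable def offspring (T : PlanarTree) (u : List ℕ) : ℕ :=
  (T.finite_offspring u).toFinset.card

/-- `T` is a finite tree. -/
def IsFin (T : PlanarTree) : Prop := T.verts.Finite

/-- The number `|T|` of edges of a finite tree: each vertex other than the root is matched with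
the edge to its parent. -/
noncomputable def size (T : PlanarTree) : ℕ := {v | v ∈ T.verts ∧ v ≠ []}.ncard

/-- The height `h(T)`, the supremum of the distances of the vertices from the root
(`⊤` if and only if `T` is infinite). -/
noncomputable def height (T : PlanarTree) : ℕ∞ := ⨆ v ∈ T.verts, (v.length : ℕ∞)

/-- The word `0 ... 0` of length `k`: if it is a vertex, then it is the leftmost vertex at
distance `k` from the root. The words of this kind in `T` are the vertices of the leftmost path
from the root. -/
def leftWord (k : ℕ) : List ℕ := List.replicate k 0

/-- The vertices of the leftmost path `ω_T` that starts at the root. -/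
def leftPath (T : PlanarTree) : Set (List ℕ) := {v | v ∈ T.verts ∧ ∃ k, v = leftWord k}

/-- `T` is one-sided: the length of the leftmost path equals the height. -/
def OneSided (T : PlanarTree) : Prop := (⨆ v ∈ T.leftPath, (v.length : ℕ∞)) = T.height

/-- The set `Ω_∞` of infinite one-sided trees. -/
def OmegaInf : Set PlanarTree := {T | T.OneSided ∧ ¬ T.IsFin}

/-- The set `Ω_N` of one-sided trees with `N` edges. -/
def Omega (N : ℕ) : Set PlanarTree := {T | T.OneSided ∧ T.IsFin ∧ T.size = N}

/-- The number `B_{m,N}` of one-sided trees with `N` edges and height `m`. -/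
noncomputable def numOmega (m N : ℕ) : ℕ := {T | T ∈ Omega N ∧ T.height = m}.ncard

/-- The partition function `W_N^{(μ)} = ∑_{m ≥ 1} e^{-μ m} B_{m,N}`. -/
noncomputable def partitionFn (μ : ℝ) (N : ℕ) : ℝ :=
  ∑' m : ℕ, Real.exp (-μ * ((m + 1 : ℕ) : ℝ)) * (numOmega (m + 1) N : ℝ)

/-- The measure `τ_N^{(μ)}`, which gives mass `e^{-μ h(T)} / W_N^{(μ)}` to each `T ∈ Ω_N`. -/
noncomputable def tauN (μ : ℝ) (N : ℕ) : Measure PlanarTree :=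
  Measure.sum fun T : Omega N =>
    ENNReal.ofReal (Real.exp (-μ * (T.1.height.toNat : ℝ)) / partitionFn μ N) • Measure.dirac T.1

/-- `τ` is the local limit of `τ_N^{(μ)}`: a Borel probability measure to which the sequence
converges weakly as `N → ∞`. -/
def IsLocalLimit (μ : ℝ) (τ : Measure PlanarTree) : Prop :=
  IsProbabilityMeasure τ ∧
    ∀ F : BoundedContinuousFunction PlanarTree ℝ,
      Tendsto (fun N => ∫ T, F T ∂(tauN μ N)) atTop (𝓝 (∫ T, F T ∂τ))

/-- The generating function `X(g) = ∑ g^{|T|}` of finite trees. -/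
noncomputable def genX (g : ℝ) : ℝ := ∑' T : {T : PlanarTree // T.IsFin}, g ^ T.1.size

/-- The radius of convergence `g_c(μ)` of the power series `∑_N W_N^{(μ)} g^N`. -/
noncomputable def gCrit (μ : ℝ) : ℝ :=
  (FormalMultilinearSeries.ofScalars ℝ (partitionFn μ)).radius.toReal

/-- `p` is a probability distribution on `{0, 1, 2, ...}` with mean less than `1`. -/
def IsSubcriticalLaw (p : ℕ → ℝ) : Prop :=
  (∀ n, 0 ≤ p n) ∧ HasSum p 1 ∧ ∃ m : ℝ, HasSum (fun n : ℕ => (n : ℝ) * p n) m ∧ m < 1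

/-- `ρ` is the (law of the) one-type BGW tree with offspring probabilities `p`. -/
def IsBGW (p : ℕ → ℝ) (ρ : Measure PlanarTree) : Prop :=
  IsProbabilityMeasure ρ ∧
    ∀ (T : PlanarTree) (r : ℕ), 1 ≤ r →
      ρ (Metric.closedBall T (1 / (r : ℝ))) =
        ENNReal.ofReal (∏ s ∈ Finset.Icc 1 (r - 1), ∏ v ∈ T.level s, p (T.offspring v))

/-- `ν` is the (law of the) two-type BGW tree with offspring probabilities `p`. The special
individuals are the vertices of the leftmost infinite path; a special individual other than the
root has `n ≥ 1` offspring with probability `p (n - 1)`, the first of which is special and the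
others normal. A normal individual has `n ≥ 0` offspring with probability `p n`, all normal. The
root is special and has a single offspring, which is special. -/
def IsTwoTypeBGW (p : ℕ → ℝ) (ν : Measure PlanarTree) : Prop :=
  IsProbabilityMeasure ν ∧ ν OmegaInfᶜ = 0 ∧
    ∀ T ∈ OmegaInf, ∀ r : ℕ, 1 ≤ r →
      ν (Metric.closedBall T (1 / (r : ℝ))) =
        ENNReal.ofReal (∏ s ∈ Finset.Icc 1 (r - 1),
          (∏ v ∈ (T.level s).erase (leftWord s), p (T.offspring v)) *
            p (T.offspring (leftWord s) - 1))

/-- The spine of `T`: the vertices with infinitely many descendants. -/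
def spine (T : PlanarTree) : Set (List ℕ) :=
  {v | v ∈ T.verts ∧ {w | w ∈ T.verts ∧ v <+: w}.Infinite}

/-- `u` is an infinite simple path in `T` that starts at the root. -/
def IsRay (T : PlanarTree) (u : ℕ → List ℕ) : Prop :=
  u 0 = [] ∧ ∀ n, u n ∈ T.verts ∧ ∃ i, u (n + 1) = u n ++ [i]

/-- The branch of `T` grafted to the right of the leftmost path at its vertex `w_s` at distance
`s ≥ 1` from the root: the root edge of the branch is the edge from `w_{s-1}` to `w_s`, and the
offspring of `w_s` in the branch are its offspring in `T` other than the leftmost one. -/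
noncomputable def branch (s : ℕ) (T : PlanarTree) : PlanarTree where
  verts := {v | v = [] ∨ v = [0] ∨
    ∃ (i : ℕ) (w : List ℕ), v = 0 :: i :: w ∧ leftWord s ++ (i + 1) :: w ∈ T.verts}
  nil_mem := Or.inl rfl
  root_degree i := by simp
  parent_mem u i h := by
    rcases h with h | h | ⟨j, w, h, hw⟩
    · simp at h
    · left
      cases u with
      | nil => rfl
      | cons a u => simp at h
    · match u with
      | [] => exact Or.inl rfl
      | [a] =>
        simp only [List.cons_append, List.nil_append, List.cons.injEq] at h
        right; left; rw [h.1]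
      | a :: b :: u =>
        simp only [List.cons_append, List.cons.injEq] at h
        obtain ⟨rfl, rfl, rfl⟩ := h
        refine Or.inr (Or.inr ⟨b, u, rfl, T.parent_mem _ i ?_⟩)
        simpa using hw
  left_mem u i j h hj := by
    rcases h with h | h | ⟨k, w, h, hw⟩
    · simp at h
    · cases u with
      | nil =>
        simp only [List.nil_append, List.cons.injEq, and_true] at h
        right; left
        simp only [List.nil_append, List.cons.injEq, and_true]
        omega
      | cons a u => simp at h
    · match u with
      | [] => simp at h
      | [a] =>
        simp only [List.cons_append, List.nil_append, List.cons.injEq] at h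
        obtain ⟨rfl, rfl, rfl⟩ := h
        exact Or.inr (Or.inr ⟨j, [], rfl, T.left_mem _ (i + 1) (j + 1) hw (by omega)⟩)
      | a :: b :: u =>
        simp only [List.cons_append, List.cons.injEq] at h
        obtain ⟨rfl, rfl, rfl⟩ := h
        refine Or.inr (Or.inr ⟨b, u ++ [j], rfl, ?_⟩)
        have := T.left_mem (leftWord s ++ (b + 1) :: u) i j (by simpa using hw) hj
        simpa using this
  finite_offspring u := by
    match u with
    | [] =>
      refine (Set.finite_singleton 0).subset ?_
      rintro i (h | h | ⟨k, w, h, -⟩)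
      · simp at h
      · simpa using h
      · simp at h
    | [a] =>
      refine ((T.finite_offspring (leftWord s)).preimage
        (f := fun i : ℕ => i + 1) (by intro x _ y _ h; simpa using h)).subset ?_
      rintro i (h | h | ⟨k, w, h, hw⟩)
      · simp at h
      · simp at h
      · simp only [List.cons_append, List.nil_append, List.cons.injEq] at h
        obtain ⟨-, rfl, rfl⟩ := h
        exact hw
    | a :: b :: u =>
      refine (T.finite_offspring (leftWord s ++ (b + 1) :: u)).subset ?_
      rintro i (h | h | ⟨k, w, h, hw⟩)
      · simp at h
      · simp at h
      · simp only [List.cons_append, List.cons.injEq] at h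
        obtain ⟨-, rfl, rfl⟩ := h
        simpa using hw

end PlanarTree

/-! ### Balls, words, and the binary decomposition of planar trees. -/

namespace PlanarTree

/-! Put `x = e^μ < 1/2`, `g = x(1-x)` and `θ = x/(1-x) < 1`, the mean of the geometric law `p`.
Under the BGW law a tree with `n` edges has mass `x^(n-1) (1-x)^n = g^n / x`, which depends on its
size only. A one-sided tree of height `m` with `N` edges is a sequence of `m` finite branches of
total size `N`, and the product of their masses is `e^(-μm) g^N`. So `τ_N` weights one-sided trees
as if their branches were independent BGW trees, given the total size.

The analytic core is that `a_N = W_N g^N` tends to the positive limit `(1-θ)²`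
(`tendsto_spineCoeff`), as in a renewal theorem: one factor is the inverse mean size of a branch,
the other the limiting weight of the one-sided trees of given height. It is proved with power
series. The series `F` of the branch sizes satisfies `F = (1-x)z + xF²`, that is `(1-F)(1-x-xF) =
(1-x)(1-z)`; this exhibits a simple factor `1-z`, and the rest is absolutely summable at `z = 1`.
The ratio test gives `g_c = g`, and total mass `1` gives `X(g) = x`.

For the local limit, fix the first `r` branches. What remains is a one-sided tree whose size is `N`
minus a constant; if it is high enough, one-sidedness puts no constraint on the fixed branches.
Trees of bounded height contribute a vanishing part of `a_N`, so the probability of these branches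
has limit inferior at least the product of their masses. This gives the portmanteau lower bound on
open sets (`spineLaw_le_liminf`) for the law of the infinite leftmost path with i.i.d. BGW branches.
Ball by ball, that law is the two-type measure (`isTwoTypeBGW_spineLaw`).

All recursions rest on `join`: a finite tree is an edge or a unique join of two finite trees. The
geometric law is the one for which an additional child costs a constant factor `x`. -/

theorem trunc_eq_iff {T T' : PlanarTree} {r : ℕ} :
    T.trunc r = T'.trunc r ↔ ∀ v : List ℕ, v.length ≤ r → (v ∈ T.verts ↔ v ∈ T'.verts) := by
  simp only [Set.ext_iff, trunc, Set.mem_ofPred_eq]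
  exact forall_congr' fun v => by tauto

theorem mem_closedBall_iff {T T' : PlanarTree} {r : ℕ} (hr : 1 ≤ r) :
    T' ∈ Metric.closedBall T (1 / (r : ℝ)) ↔ T'.trunc r = T.trunc r := by
  rw [Metric.mem_closedBall]
  change sInf (agreement T' T) ≤ _ ↔ _
  constructor
  · intro h
    have hr' : (1 : ℝ) ≤ r := by exact_mod_cast hr
    -- The number `r - 1/2` makes the bound on the infimum strict, so that a witness `s` exists; and
    -- `s > r - 1/2` still forces `s ≥ r`.
    obtain ⟨x, ⟨s, hs, hs', rfl⟩, hlt⟩ := exists_lt_of_csInf_lt (agreement_nonempty T' T)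
      (show sInf (agreement T' T) < 1 / ((r : ℝ) - 1 / 2) from
        h.trans_lt (one_div_lt_one_div_of_lt (by linarith) (by linarith)))
    have hs0 : (0 : ℝ) < s := by exact_mod_cast hs
    have h1 : (r : ℝ) - 1 / 2 < s := (one_div_lt_one_div hs0 (by linarith)).1 hlt
    have h2 : (r : ℝ) < (s + 1 : ℕ) := by push_cast; linarith
    exact trunc_mono hs' (by have := Nat.cast_lt.1 h2; omega)
  · exact fun h => csInf_le (agreement_bddBelow T' T) ⟨r, hr, h, rfl⟩

theorem mem_of_append {T : PlanarTree} {u w : List ℕ} (h : u ++ w ∈ T.verts) : u ∈ T.verts := by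
  induction w using List.reverseRecOn with
  | nil => simpa using h
  | append_singleton w i ih => exact ih (T.parent_mem _ i (by simpa using h))

theorem head_eq_zero {T : PlanarTree} {a : ℕ} {w : List ℕ} (h : a :: w ∈ T.verts) : a = 0 :=
  (T.root_degree a).1 (mem_of_append (u := [a]) (w := w) (by simpa using h))

theorem zero_mem (T : PlanarTree) : [0] ∈ T.verts := (T.root_degree 0).2 rfl

theorem verts_cases {P : List ℕ → Prop} {T : PlanarTree} (h0 : P []) (h1 : P [0])
    (h2 : ∀ i w, 0 :: i :: w ∈ T.verts → P (0 :: i :: w)) : ∀ v ∈ T.verts, P v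
  | [], _ => h0
  | [a], h => by obtain rfl := head_eq_zero h; exact h1
  | a :: i :: w, h => by obtain rfl := head_eq_zero h; exact h2 i w h

theorem ext_of_cons {T T' : PlanarTree}
    (h : ∀ i w, 0 :: i :: w ∈ T.verts ↔ 0 :: i :: w ∈ T'.verts) : T = T' := by
  ext v
  constructor
  · exact fun hv => verts_cases (P := fun v => v ∈ T'.verts) T'.nil_mem T'.zero_mem
      (fun i w hw => (h i w).1 hw) v hv
  · exact fun hv => verts_cases (P := fun v => v ∈ T.verts) T.nil_mem T.zero_mem
      (fun i w hw => (h i w).2 hw) v hv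

theorem trunc_eq_iff_cons {T T' : PlanarTree} {r : ℕ} :
    T.trunc r = T'.trunc r ↔
      ∀ i w, List.length w + 2 ≤ r → (0 :: i :: w ∈ T.verts ↔ 0 :: i :: w ∈ T'.verts) := by
  rw [trunc_eq_iff]
  constructor
  · exact fun h i w hw => h _ (by simp; omega)
  · intro h v
    match v with
    | [] => simp [T.nil_mem, T'.nil_mem]
    | [a] => simp [T.root_degree, T'.root_degree]
    | a :: i :: w =>
      intro hw
      by_cases ha : a = 0
      · subst ha
        exact h i w (by simp at hw; omega)
      · exact iff_of_false (fun h => ha (head_eq_zero h)) (fun h => ha (head_eq_zero h))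

/-- The tree with a single edge. -/
def edge : PlanarTree where
  verts := {[], [0]}
  nil_mem := by simp
  root_degree := by simp
  parent_mem u i h := by
    match u, h with
    | [], _ => simp
    | [a], h => simp at h
    | a :: b :: u, h => simp at h
  left_mem u i j h hj := by
    match u, h with
    | [], h => simp at h ⊢; omega
    | [a], h => simp at h
    | a :: b :: u, h => simp at h
  finite_offspring u := by
    refine (Set.finite_singleton 0).subset fun i hi => ?_
    match u, hi with
    | [], hi => simpa using hi
    | [a], hi => simp at hi
    | a :: b :: u, hi => simp at hi

/-- The tree in which the top vertex `[0]` has a new leftmost child, with the descendants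
prescribed by `A`, in front of the children that it has in `B`. -/
def join (A B : PlanarTree) : PlanarTree where
  verts := {v | v = [] ∨ v = [0] ∨ (∃ w, v = 0 :: 0 :: w ∧ 0 :: w ∈ A.verts) ∨
    ∃ i w, v = 0 :: (i + 1) :: w ∧ 0 :: i :: w ∈ B.verts}
  nil_mem := Or.inl rfl
  root_degree := by simp
  parent_mem u i h := by
    match u with
    | [] => exact Or.inl rfl
    | [a] => rcases h with h | h | ⟨w, h, hw⟩ | ⟨j, w, h, hw⟩ <;> simp at h <;> simp [h.1]
    | a :: b :: u =>
      rcases h with h | h | ⟨w, h, hw⟩ | ⟨j, w, h, hw⟩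
      · simp at h
      · simp at h
      · simp only [List.cons_append, List.cons.injEq] at h
        obtain ⟨rfl, rfl, rfl⟩ := h
        exact Or.inr (Or.inr (Or.inl ⟨u, rfl, A.parent_mem _ i (by simpa using hw)⟩))
      · simp only [List.cons_append, List.cons.injEq] at h
        obtain ⟨rfl, rfl, rfl⟩ := h
        exact Or.inr (Or.inr (Or.inr ⟨j, u, rfl, B.parent_mem _ i (by simpa using hw)⟩))
  left_mem u i j h hj := by
    match u with
    | [] =>
      rcases h with h | h | ⟨w, h, hw⟩ | ⟨k, w, h, hw⟩ <;> simp at h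
      right; left; simp; omega
    | [a] =>
      rcases h with h | h | ⟨w, h, hw⟩ | ⟨k, w, h, hw⟩
      · simp at h
      · simp at h
      · simp only [List.cons_append, List.nil_append, List.cons.injEq] at h
        obtain ⟨rfl, rfl, rfl⟩ := h
        obtain rfl : j = 0 := by omega
        exact Or.inr (Or.inr (Or.inl ⟨[], rfl, hw⟩))
      · simp only [List.cons_append, List.nil_append, List.cons.injEq] at h
        obtain ⟨rfl, rfl, rfl⟩ := h
        cases j with
        | zero => exact Or.inr (Or.inr (Or.inl ⟨[], rfl, A.zero_mem⟩))
        | succ j =>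
          exact Or.inr (Or.inr (Or.inr ⟨j, [], rfl, B.left_mem [0] k j hw (by omega)⟩))
    | a :: b :: u =>
      rcases h with h | h | ⟨w, h, hw⟩ | ⟨k, w, h, hw⟩
      · simp at h
      · simp at h
      · simp only [List.cons_append, List.cons.injEq] at h
        obtain ⟨rfl, rfl, rfl⟩ := h
        exact Or.inr (Or.inr (Or.inl ⟨u ++ [j], rfl, A.left_mem (0 :: u) i j (by simpa using hw) hj⟩))
      · simp only [List.cons_append, List.cons.injEq] at h
        obtain ⟨rfl, rfl, rfl⟩ := h
        exact Or.inr (Or.inr (Or.inr ⟨k, u ++ [j], rfl,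
          B.left_mem (0 :: k :: u) i j (by simpa using hw) hj⟩))
  finite_offspring u := by
    match u with
    | [] =>
      refine (Set.finite_singleton 0).subset ?_
      rintro i (h | h | ⟨w, h, hw⟩ | ⟨k, w, h, hw⟩) <;> simp at h
      simpa using h
    | [a] =>
      refine (((B.finite_offspring [0]).image (fun i => i + 1)).insert 0).subset ?_
      rintro i (h | h | ⟨w, h, hw⟩ | ⟨k, w, h, hw⟩)
      · simp at h
      · simp at h
      · simp only [List.cons_append, List.nil_append, List.cons.injEq] at h
        exact Or.inl h.2.1
      · simp only [List.cons_append, List.nil_append, List.cons.injEq] at h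
        obtain ⟨rfl, rfl, rfl⟩ := h
        exact Or.inr ⟨k, hw, rfl⟩
    | a :: b :: u =>
      cases b with
      | zero =>
        refine (A.finite_offspring (0 :: u)).subset ?_
        rintro i (h | h | ⟨w, h, hw⟩ | ⟨k, w, h, hw⟩) <;> simp at h
        obtain ⟨rfl, rfl⟩ := h
        exact hw
      | succ b =>
        refine (B.finite_offspring (0 :: b :: u)).subset ?_
        rintro i (h | h | ⟨w, h, hw⟩ | ⟨k, w, h, hw⟩) <;> simp at h
        obtain ⟨rfl, rfl, rfl⟩ := h
        exact hw

@[simp] theorem mem_join_zero {A B : PlanarTree} {w : List ℕ} :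
    0 :: 0 :: w ∈ (join A B).verts ↔ 0 :: w ∈ A.verts := by
  simp [join]

@[simp] theorem mem_join_succ {A B : PlanarTree} {i : ℕ} {w : List ℕ} :
    0 :: (i + 1) :: w ∈ (join A B).verts ↔ 0 :: i :: w ∈ B.verts := by
  simp [join]

@[simp] theorem mem_edge {i : ℕ} {w : List ℕ} : 0 :: i :: w ∉ edge.verts := by
  simp [edge]

@[simp] theorem mem_branch {T : PlanarTree} {s i : ℕ} {w : List ℕ} :
    0 :: i :: w ∈ (branch s T).verts ↔ leftWord s ++ (i + 1) :: w ∈ T.verts := by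
  simp [branch]

/-- The leftmost child of the top vertex `[0]` with its descendants and the edge to `[0]` as the
root edge; a single edge if `[0]` has no children. -/
def child (T : PlanarTree) : PlanarTree where
  verts := {v | v = [] ∨ v = [0] ∨ ∃ w, v = 0 :: w ∧ 0 :: 0 :: w ∈ T.verts}
  nil_mem := Or.inl rfl
  root_degree i := by
    simp only [Set.mem_ofPred_eq, List.cons.injEq, and_true, reduceCtorEq, false_or]
    exact ⟨by rintro (h | ⟨w, ⟨h, -⟩, -⟩) <;> exact h, Or.inl⟩
  parent_mem u i h := by
    match u with
    | [] => exact Or.inl rfl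
    | a :: u =>
      rcases h with h | h | ⟨w, h, hw⟩
      · simp at h
      · simp at h
      · simp only [List.cons_append, List.cons.injEq] at h
        obtain ⟨rfl, rfl⟩ := h
        exact Or.inr (Or.inr ⟨u, rfl, T.parent_mem _ i (by simpa using hw)⟩)
  left_mem u i j h hj := by
    match u with
    | [] =>
      right; left
      rcases h with h | h | ⟨w, h, hw⟩ <;> simp at h ⊢ <;> omega
    | a :: u =>
      rcases h with h | h | ⟨w, h, hw⟩
      · simp at h
      · simp at h
      · simp only [List.cons_append, List.cons.injEq] at h
        obtain ⟨rfl, rfl⟩ := h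
        exact Or.inr (Or.inr ⟨u ++ [j], rfl, T.left_mem (0 :: 0 :: u) i j (by simpa using hw) hj⟩)
  finite_offspring u := by
    match u with
    | [] =>
      refine (Set.finite_singleton 0).subset ?_
      rintro i (h | h | ⟨w, h, hw⟩) <;> simp at h
      · simpa using h
      · simpa using h.1
    | a :: u =>
      refine (T.finite_offspring (0 :: 0 :: u)).subset ?_
      rintro i (h | h | ⟨w, h, hw⟩)
      · simp at h
      · simp at h
      · simp only [List.cons_append, List.cons.injEq] at h
        obtain ⟨rfl, rfl⟩ := h
        exact hw

@[simp] theorem mem_child {T : PlanarTree} {i : ℕ} {w : List ℕ} :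
    0 :: i :: w ∈ (child T).verts ↔ 0 :: 0 :: i :: w ∈ T.verts := by
  simp [child]

@[simp] theorem child_join (A B : PlanarTree) : child (join A B) = A :=
  ext_of_cons fun i w => by simp

theorem branch_one_mem {T : PlanarTree} {i : ℕ} {w : List ℕ} :
    0 :: i :: w ∈ (branch 1 T).verts ↔ 0 :: (i + 1) :: w ∈ T.verts := by
  rw [mem_branch]; rfl

@[simp] theorem branch_one_join (A B : PlanarTree) : branch 1 (join A B) = B :=
  ext_of_cons fun i w => by rw [branch_one_mem, mem_join_succ]

/-- Passing to `child T` removes the first edge of the leftmost path, so every branch is a first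
branch after iterating `child`. -/
theorem branch_add_two (s : ℕ) (T : PlanarTree) : branch (s + 2) T = branch (s + 1) (child T) :=
  ext_of_cons fun i w => by
    rw [mem_branch, mem_branch]
    cases s <;> simp [leftWord, List.replicate_succ]

theorem eq_join_of_mem {T : PlanarTree} (h : [0, 0] ∈ T.verts) :
    T = join (child T) (branch 1 T) :=
  ext_of_cons fun i w => by
    match i, w with
    | 0, [] => simp [h, zero_mem]
    | 0, j :: w => simp
    | i + 1, w => rw [mem_join_succ, branch_one_mem]

theorem eq_edge_of_notMem {T : PlanarTree} (h : [0, 0] ∉ T.verts) : T = edge :=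
  ext_of_cons fun i w => by
    refine iff_of_false (fun hw => h ?_) mem_edge
    exact T.left_mem [0] i 0 (mem_of_append (u := [0, i]) (w := w) (by simpa using hw)) (by omega)

theorem eq_edge_or_join (T : PlanarTree) : T = edge ∨ ∃ A B, T = join A B := by
  by_cases h : [0, 0] ∈ T.verts
  · exact Or.inr ⟨_, _, eq_join_of_mem h⟩
  · exact Or.inl (eq_edge_of_notMem h)

theorem join_inj {A B A' B' : PlanarTree} : join A B = join A' B' ↔ A = A' ∧ B = B' := by
  refine ⟨fun h => ⟨?_, ?_⟩, by rintro ⟨rfl, rfl⟩; rfl⟩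
  · simpa using congrArg child h
  · simpa using congrArg (branch 1) h

theorem join_mem_zero_zero (A B : PlanarTree) : [0, 0] ∈ (join A B).verts := by
  simp [zero_mem]

theorem edge_ne_join (A B : PlanarTree) : edge ≠ join A B := fun h =>
  mem_edge (h ▸ join_mem_zero_zero A B)

/-- `A` hangs one level below the root while `B` shares the root edge; hence the radii `r` and `r +
1`. -/
theorem trunc_join_eq_iff {A B A' B' : PlanarTree} {r : ℕ} :
    (join A B).trunc (r + 1) = (join A' B').trunc (r + 1) ↔
      A.trunc r = A'.trunc r ∧ B.trunc (r + 1) = B'.trunc (r + 1) := by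
  rw [trunc_eq_iff_cons, trunc_eq_iff_cons, trunc_eq_iff_cons]
  constructor
  · intro h
    refine ⟨fun i w hw => ?_, fun i w hw => ?_⟩
    · simpa using h 0 (i :: w) (by simpa using hw)
    · simpa using h (i + 1) w hw
  · rintro ⟨h1, h2⟩ i w hw
    match i, w with
    | 0, [] => simp [zero_mem]
    | 0, j :: w => simpa using h1 j w (by simpa using hw)
    | i + 1, w => simpa using h2 i w hw

theorem trunc_edge_ne_join {A B : PlanarTree} {r : ℕ} :
    (join A B).trunc (r + 2) ≠ edge.trunc (r + 2) := fun h =>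
  mem_edge ((trunc_eq_iff.1 h [0, 0] (by simp)).1 (join_mem_zero_zero A B))

/-- The embedding of the vertices of `B` into those of `join A B`. -/
def shift : List ℕ → List ℕ
  | a :: i :: w => a :: (i + 1) :: w
  | l => l

theorem shift_injective : Function.Injective shift := by
  rintro (_ | ⟨a, _ | ⟨i, w⟩⟩) (_ | ⟨b, _ | ⟨j, w'⟩⟩) h <;> simp_all [shift]

@[simp] theorem length_shift : ∀ v : List ℕ, (shift v).length = v.length
  | [] => rfl
  | [_] => rfl
  | _ :: _ :: _ => rfl

theorem cons_ne_shift {u v : List ℕ} (h : 2 ≤ (0 :: u).length) (hu : ∃ w, u = 0 :: w) :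
    0 :: u ≠ shift v := by
  obtain ⟨w, rfl⟩ := hu
  match v with
  | [] => simp [shift]
  | [a] => simp [shift]
  | a :: b :: v => simp [shift]

/-! ### Levels and offspring numbers of a join. -/

theorem mem_level {T : PlanarTree} {s : ℕ} {v : List ℕ} :
    v ∈ T.level s ↔ v ∈ T.verts ∧ v.length = s := by
  simp [level]

theorem level_one (T : PlanarTree) : T.level 1 = {[0]} := by
  ext v
  rw [mem_level, Finset.mem_singleton]
  constructor
  · rintro ⟨hv, hl⟩
    match v, hl with
    | [a], _ => rw [head_eq_zero hv]
  · rintro rfl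
    exact ⟨T.zero_mem, rfl⟩

theorem level_edge (s : ℕ) : edge.level (s + 2) = ∅ := by
  ext v
  rw [mem_level]
  simp only [Finset.notMem_empty, iff_false, not_and]
  intro h hl
  rcases h with rfl | rfl <;> simp at hl

theorem level_join (A B : PlanarTree) (s : ℕ) : (join A B).level (s + 2) =
    (A.level (s + 1)).image (List.cons 0) ∪ (B.level (s + 2)).image shift := by
  ext v
  simp only [Finset.mem_union, Finset.mem_image, mem_level]
  constructor
  · rintro ⟨hv, hl⟩
    match v, hl with
    | a :: 0 :: w, hl =>
      obtain rfl := head_eq_zero hv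
      exact Or.inl ⟨0 :: w, ⟨mem_join_zero.1 hv, by simpa using hl⟩, rfl⟩
    | a :: (i + 1) :: w, hl =>
      obtain rfl := head_eq_zero hv
      exact Or.inr ⟨0 :: i :: w, ⟨mem_join_succ.1 hv, by simpa using hl⟩, rfl⟩
  · rintro (⟨u, ⟨hu, hl⟩, rfl⟩ | ⟨u, ⟨hu, hl⟩, rfl⟩)
    · match u, hl with
      | a :: w, hl =>
        obtain rfl := head_eq_zero hu
        exact ⟨mem_join_zero.2 hu, by simpa using hl⟩
    · match u, hl with
      | a :: i :: w, hl =>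
        obtain rfl := head_eq_zero hu
        exact ⟨mem_join_succ.2 hu, by simpa using hl⟩

theorem level_join_disjoint (A B : PlanarTree) (s : ℕ) :
    Disjoint ((A.level (s + 1)).image (List.cons 0)) ((B.level (s + 2)).image shift) := by
  rw [Finset.disjoint_left]
  intro v hv hv'
  simp only [Finset.mem_image, mem_level] at hv hv'
  obtain ⟨u, ⟨hu, hl⟩, rfl⟩ := hv
  obtain ⟨u', -, h⟩ := hv'
  match u, hl with
  | a :: w, hl =>
    obtain rfl := head_eq_zero hu
    exact cons_ne_shift (by simp) ⟨w, rfl⟩ h.symm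

theorem offspring_congr {T T' : PlanarTree} {u u' : List ℕ}
    (h : ∀ i, u ++ [i] ∈ T.verts ↔ u' ++ [i] ∈ T'.verts) : T.offspring u = T'.offspring u' := by
  simp only [offspring, h]

theorem offspring_join_top (A B : PlanarTree) :
    (join A B).offspring [0] = B.offspring [0] + 1 := by
  have h : ((join A B).finite_offspring [0]).toFinset =
      insert 0 ((B.finite_offspring [0]).toFinset.image Nat.succ) := by
    ext i
    cases i with
    | zero => simp [zero_mem]
    | succ i => simp
  rw [offspring, h, Finset.card_insert_of_notMem (by simp),
    Finset.card_image_of_injective _ Nat.succ_injective, offspring]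

theorem offspring_edge_top : edge.offspring [0] = 0 := by
  simp [offspring]

theorem offspring_join_left {A B : PlanarTree} {v : List ℕ} {s : ℕ} (hv : v ∈ A.level (s + 1)) :
    (join A B).offspring (0 :: v) = A.offspring v := by
  rw [mem_level] at hv
  match v, hv with
  | a :: w, hv =>
    obtain rfl := head_eq_zero hv.1
    exact offspring_congr fun i => by simp

theorem offspring_join_right {A B : PlanarTree} {v : List ℕ} {s : ℕ} (hv : v ∈ B.level (s + 2)) :
    (join A B).offspring (shift v) = B.offspring v := by
  rw [mem_level] at hv
  match v, hv with
  | a :: i :: w, hv =>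
    obtain rfl := head_eq_zero hv.1
    exact offspring_congr fun i => by simp [shift]

theorem prod_level_join (A B : PlanarTree) (s : ℕ) (p : ℕ → ℝ) :
    ∏ v ∈ (join A B).level (s + 2), p ((join A B).offspring v) =
      (∏ v ∈ A.level (s + 1), p (A.offspring v)) * ∏ v ∈ B.level (s + 2), p (B.offspring v) := by
  rw [level_join, Finset.prod_union (level_join_disjoint A B s),
    Finset.prod_image (fun _ _ _ _ h => (List.cons.inj h).2),
    Finset.prod_image (fun _ _ _ _ h => shift_injective h)]
  congr 1
  · exact Finset.prod_congr rfl fun v hv => by rw [offspring_join_left hv]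
  · exact Finset.prod_congr rfl fun v hv => by rw [offspring_join_right hv]

/-- The leftmost vertex of a level lies in the copy of `A`, so `B` enters with its full levels:
below the top vertex it contains normal individuals only. -/
theorem prod_level_erase_join (A B : PlanarTree) (s : ℕ) (p : ℕ → ℝ) :
    ∏ v ∈ ((join A B).level (s + 2)).erase (leftWord (s + 2)), p ((join A B).offspring v) =
      (∏ v ∈ (A.level (s + 1)).erase (leftWord (s + 1)), p (A.offspring v)) *
        ∏ v ∈ B.level (s + 2), p (B.offspring v) := by
  have h : ((join A B).level (s + 2)).erase (leftWord (s + 2)) =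
      ((A.level (s + 1)).erase (leftWord (s + 1))).image (List.cons 0) ∪
        (B.level (s + 2)).image shift := by
    rw [level_join, Finset.erase_union_distrib,
      Finset.image_erase (fun _ _ h => (List.cons.inj h).2)]
    congr 1
    refine Finset.erase_eq_of_notMem fun h => ?_
    obtain ⟨v, -, hv⟩ := Finset.mem_image.1 h
    exact cons_ne_shift (u := leftWord (s + 1)) (by simp [leftWord]) ⟨leftWord s, rfl⟩ hv.symm
  rw [h, Finset.prod_union, Finset.prod_image (fun _ _ _ _ h => (List.cons.inj h).2),
    Finset.prod_image (fun _ _ _ _ h => shift_injective h)]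
  · congr 1
    · exact Finset.prod_congr rfl fun v hv => by
        rw [offspring_join_left (Finset.mem_of_mem_erase hv)]
    · exact Finset.prod_congr rfl fun v hv => by rw [offspring_join_right hv]
  · exact (level_join_disjoint A B s).mono_left (Finset.image_subset_image (Finset.erase_subset _ _))

end PlanarTree

/-! ### Codes of finite trees, and one-sidedness in terms of codes. -/

/-- Codes of the finite planar trees: a finite tree is a single edge, or is obtained from two
finite trees by `PlanarTree.join`. -/
inductive FinTree
  | edge : FinTree
  | join : FinTree → FinTree → FinTree

namespace FinTree

/-- The planar tree with a given code. -/
def toTree : FinTree → PlanarTree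
  | edge => PlanarTree.edge
  | join A B => PlanarTree.join A.toTree B.toTree

/-- The number of edges. -/
def size : FinTree → ℕ
  | edge => 1
  | join A B => A.size + B.size

/-- The height. -/
def height : FinTree → ℕ
  | edge => 1
  | join A B => max (A.height + 1) B.height

/-- The length of the leftmost path. -/
def leftLength : FinTree → ℕ
  | edge => 1
  | join A _ => A.leftLength + 1

/-- The code belongs to a one-sided tree. -/
def OneSided (c : FinTree) : Prop := c.leftLength = c.height

instance (c : FinTree) : Decidable c.OneSided := inferInstanceAs (Decidable (_ = _))

theorem size_pos : ∀ c : FinTree, 1 ≤ c.size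
  | edge => le_rfl
  | join A B => by have := size_pos A; simp only [size]; omega

theorem height_pos : ∀ c : FinTree, 1 ≤ c.height
  | edge => le_rfl
  | join A B => by have := height_pos A; simp only [height]; omega

theorem leftLength_le_height : ∀ c : FinTree, c.leftLength ≤ c.height
  | edge => le_rfl
  | join A B => by have := leftLength_le_height A; simp only [height, leftLength]; omega

theorem oneSided_edge : edge.OneSided := rfl

/-- The leftmost path of the join is that of `A` prolonged by one edge; it must reach the height of
`A` plus one, and `B` may not rise above it. -/
theorem oneSided_join {A B : FinTree} :
    (join A B).OneSided ↔ A.OneSided ∧ B.height ≤ A.height + 1 := by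
  have := leftLength_le_height A
  simp only [OneSided, leftLength, height]
  omega

theorem height_join_of_oneSided {A B : FinTree} (h : (join A B).OneSided) :
    (join A B).height = A.height + 1 := by
  have := (oneSided_join.1 h).2
  simp only [height]
  omega

theorem toTree_injective : Function.Injective toTree := by
  intro A
  induction A with
  | edge =>
    rintro (_ | ⟨A', B'⟩) h
    · rfl
    · exact absurd h (PlanarTree.edge_ne_join _ _)
  | join A B ihA ihB =>
    rintro (_ | ⟨A', B'⟩) h
    · exact absurd h.symm (PlanarTree.edge_ne_join _ _)
    · obtain ⟨h1, h2⟩ := PlanarTree.join_inj.1 h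
      rw [ihA h1, ihB h2]

theorem length_le_height (c : FinTree) : ∀ v ∈ c.toTree.verts, v.length ≤ c.height := by
  induction c with
  | edge => rintro v (rfl | rfl) <;> simp [height]
  | join A B ihA ihB =>
    rintro v (rfl | rfl | ⟨w, rfl, hw⟩ | ⟨i, w, rfl, hw⟩)
    · simp
    · simp [height]
    · have := ihA _ hw
      simp only [List.length_cons, height] at this ⊢
      omega
    · have := ihB _ hw
      simp only [List.length_cons, height] at this ⊢
      omega

theorem exists_length_eq_height (c : FinTree) :
    ∃ w, 0 :: w ∈ c.toTree.verts ∧ w.length + 1 = c.height := by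
  induction c with
  | edge => exact ⟨[], PlanarTree.zero_mem _, rfl⟩
  | join A B ihA ihB =>
    obtain ⟨u, hu, hu'⟩ := ihA
    obtain ⟨v, hv, hv'⟩ := ihB
    rcases le_total B.height (A.height + 1) with h | h
    · refine ⟨0 :: u, PlanarTree.mem_join_zero.2 hu, ?_⟩
      simp only [List.length_cons, height]
      omega
    · match v, hv, hv' with
      | [], hv, hv' =>
        have := height_pos A
        simp at hv'
        omega
      | i :: w, hv, hv' =>
        refine ⟨(i + 1) :: w, PlanarTree.mem_join_succ.2 hv, ?_⟩
        simp only [List.length_cons, height] at hv' ⊢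
        omega

theorem height_toTree (c : FinTree) : c.toTree.height = c.height := by
  apply le_antisymm
  · exact iSup₂_le fun v hv => by exact_mod_cast length_le_height c v hv
  · obtain ⟨w, hw, h⟩ := exists_length_eq_height c
    rw [← h]
    exact le_iSup₂ (f := fun (v : List ℕ) (_ : v ∈ c.toTree.verts) => (v.length : ℕ∞)) _ hw

theorem leftWord_mem_toTree (c : FinTree) :
    ∀ k, PlanarTree.leftWord k ∈ c.toTree.verts ↔ k ≤ c.leftLength := by
  induction c with
  | edge =>
    intro k
    match k with
    | 0 => simp [PlanarTree.leftWord, PlanarTree.nil_mem]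
    | 1 => simp [PlanarTree.leftWord, PlanarTree.zero_mem, leftLength]
    | k + 2 =>
      refine iff_of_false (PlanarTree.mem_edge (w := PlanarTree.leftWord k)) ?_
      simp [leftLength]
  | join A B ihA ihB =>
    intro k
    match k with
    | 0 => simp [PlanarTree.leftWord, PlanarTree.nil_mem]
    | 1 => simp [PlanarTree.leftWord, PlanarTree.zero_mem, leftLength]
    | k + 2 =>
      refine (PlanarTree.mem_join_zero (w := PlanarTree.leftWord k)).trans ((ihA (k + 1)).trans ?_)
      simp [leftLength]

theorem oneSided_toTree (c : FinTree) : c.toTree.OneSided ↔ c.OneSided := by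
  have h : (⨆ v ∈ c.toTree.leftPath, (v.length : ℕ∞)) = c.leftLength := by
    apply le_antisymm
    · refine iSup₂_le ?_
      rintro v ⟨hv, k, rfl⟩
      have := (leftWord_mem_toTree c k).1 hv
      simpa [PlanarTree.leftWord] using this
    · have hm := (leftWord_mem_toTree c c.leftLength).2 le_rfl
      refine le_trans ?_ (le_iSup₂ (f := fun (v : List ℕ) (_ : v ∈ c.toTree.leftPath) =>
        (v.length : ℕ∞)) (PlanarTree.leftWord c.leftLength) ⟨hm, _, rfl⟩)
      simp [PlanarTree.leftWord]
  rw [PlanarTree.OneSided, h, height_toTree, OneSided, Nat.cast_inj]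

end FinTree

/-! ### Number of edges of a join; every finite tree has a code. -/

namespace PlanarTree

/-- The vertices other than the root. -/
def nonroot (T : PlanarTree) : Set (List ℕ) := {v | v ∈ T.verts ∧ v ≠ []}

theorem nonroot_edge : edge.nonroot = {[0]} := by
  ext v
  simp only [nonroot, edge, Set.mem_insert_iff, Set.mem_singleton_iff, Set.mem_ofPred_eq]
  constructor
  · tauto
  · rintro rfl
    simp

theorem isFin_iff {T : PlanarTree} : T.IsFin ↔ T.nonroot.Finite := by
  refine ⟨fun h => h.subset fun v hv => hv.1, fun h => (h.insert []).subset fun v hv => ?_⟩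
  by_cases hv0 : v = []
  · exact Or.inl hv0
  · exact Or.inr ⟨hv, hv0⟩

theorem nonroot_join (A B : PlanarTree) :
    (join A B).nonroot = List.cons 0 '' A.nonroot ∪ shift '' B.nonroot := by
  ext v
  constructor
  · rintro ⟨rfl | rfl | ⟨w, rfl, hw⟩ | ⟨i, w, rfl, hw⟩, h⟩
    · exact absurd rfl h
    · exact Or.inr ⟨[0], ⟨B.zero_mem, by simp⟩, rfl⟩
    · exact Or.inl ⟨0 :: w, ⟨hw, by simp⟩, rfl⟩
    · exact Or.inr ⟨0 :: i :: w, ⟨hw, by simp⟩, rfl⟩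
  · rintro (⟨u, ⟨hu, h⟩, rfl⟩ | ⟨u, ⟨hu, h⟩, rfl⟩)
    · match u, h with
      | a :: u, _ =>
        obtain rfl := head_eq_zero hu
        exact ⟨mem_join_zero.2 hu, by simp⟩
    · match u, h with
      | [a], _ =>
        obtain rfl := head_eq_zero hu
        exact ⟨zero_mem _, by simp [shift]⟩
      | a :: i :: w, _ =>
        obtain rfl := head_eq_zero hu
        exact ⟨mem_join_succ.2 hu, by simp [shift]⟩

theorem isFin_join {A B : PlanarTree} : (join A B).IsFin ↔ A.IsFin ∧ B.IsFin := by
  rw [isFin_iff, isFin_iff, isFin_iff, nonroot_join, Set.finite_union,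
    Set.finite_image_iff (List.cons_injective.injOn), Set.finite_image_iff shift_injective.injOn]

theorem size_edge : edge.size = 1 := by
  change edge.nonroot.ncard = 1
  rw [nonroot_edge, Set.ncard_singleton]

theorem size_join {A B : PlanarTree} (hA : A.IsFin) (hB : B.IsFin) :
    (join A B).size = A.size + B.size := by
  change (join A B).nonroot.ncard = A.nonroot.ncard + B.nonroot.ncard
  rw [nonroot_join, Set.ncard_union_eq _ ((isFin_iff.1 hA).image _) ((isFin_iff.1 hB).image _),
    Set.ncard_image_of_injective _ List.cons_injective,
    Set.ncard_image_of_injective _ shift_injective]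
  · rw [Set.disjoint_left]
    rintro v ⟨u, ⟨hu, h⟩, rfl⟩ ⟨u', -, h'⟩
    match u, h with
    | a :: w, _ =>
      obtain rfl := head_eq_zero hu
      exact cons_ne_shift (by simp) ⟨w, rfl⟩ h'.symm

theorem size_pos {T : PlanarTree} (h : T.IsFin) : 1 ≤ T.size := by
  change 0 < T.nonroot.ncard
  rw [Set.ncard_pos (isFin_iff.1 h)]
  exact ⟨[0], T.zero_mem, by simp⟩

theorem exists_code : ∀ (n : ℕ) (T : PlanarTree), T.IsFin → T.size ≤ n →
    ∃ c : FinTree, c.toTree = T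
  | 0, T, h, hn => by have := size_pos h; omega
  | n + 1, T, h, hn => by
    rcases eq_edge_or_join T with rfl | ⟨A, B, rfl⟩
    · exact ⟨.edge, rfl⟩
    · obtain ⟨hA, hB⟩ := isFin_join.1 h
      rw [size_join hA hB] at hn
      have := size_pos hA
      have := size_pos hB
      obtain ⟨a, ha⟩ := exists_code n A hA (by omega)
      obtain ⟨b, hb⟩ := exists_code n B hB (by omega)
      exact ⟨.join a b, by rw [← ha, ← hb]; rfl⟩

end PlanarTree

/-! ### Enumeration of codes by size, and the partition function as a finite sum. -/

namespace FinTree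

theorem isFin_toTree : ∀ c : FinTree, c.toTree.IsFin
  | edge => PlanarTree.isFin_iff.2 (by
      change PlanarTree.edge.nonroot.Finite
      rw [PlanarTree.nonroot_edge]
      exact Set.finite_singleton _)
  | join A B => PlanarTree.isFin_join.2 ⟨isFin_toTree A, isFin_toTree B⟩

theorem size_toTree : ∀ c : FinTree, c.toTree.size = c.size
  | edge => PlanarTree.size_edge
  | join A B => (PlanarTree.size_join (isFin_toTree A) (isFin_toTree B)).trans (by
      rw [size_toTree A, size_toTree B]; rfl)

theorem range_toTree : Set.range toTree = {T | T.IsFin} := by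
  ext T
  constructor
  · rintro ⟨c, rfl⟩
    exact isFin_toTree c
  · exact fun h => PlanarTree.exists_code _ T h le_rfl

theorem finite_size_le : ∀ n, {c : FinTree | c.size ≤ n}.Finite
  | 0 => Set.finite_empty.subset fun c hc => by
      have := size_pos c
      have : c.size ≤ 0 := hc
      omega
  | n + 1 => by
    refine (((finite_size_le n).image2 join (finite_size_le n)).insert edge).subset ?_
    rintro (_ | ⟨A, B⟩) h
    · exact Or.inl rfl
    · have := size_pos A
      have := size_pos B
      have : A.size + B.size ≤ n + 1 := h
      exact Or.inr ⟨A, show A.size ≤ n by omega, B, show B.size ≤ n by omega, rfl⟩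

instance : Countable FinTree := by
  rw [← Set.countable_univ_iff]
  refine (Set.countable_iUnion fun n => (finite_size_le n).countable).mono ?_
  exact fun c _ => Set.mem_iUnion.2 ⟨c.size, le_refl c.size⟩

/-- The codes of the trees with `n` edges. -/
noncomputable def ofSize (n : ℕ) : Finset FinTree :=
  (show {c : FinTree | c.size = n}.Finite from
    (finite_size_le n).subset fun c (hc : c.size = n) => show c.size ≤ n from hc.le).toFinset

@[simp] theorem mem_ofSize {n : ℕ} {c : FinTree} : c ∈ ofSize n ↔ c.size = n := by
  rw [ofSize, Set.Finite.mem_toFinset]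
  rfl

/-- Size is additive under `join`, so this turns weights that are multiplicative under `join` into
convolution equations for their generating functions. -/
theorem sum_ofSize {M : Type*} [AddCommMonoid M] (W : FinTree → M) (n : ℕ) :
    ∑ c ∈ ofSize n, W c = (if n = 1 then W edge else 0) +
      ∑ ij ∈ Finset.HasAntidiagonal.antidiagonal n,
        ∑ A ∈ ofSize ij.1, ∑ B ∈ ofSize ij.2, W (join A B) := by
  classical
  have hdis : Disjoint (if n = 1 then {edge} else ∅ : Finset FinTree)
      ((Finset.HasAntidiagonal.antidiagonal n).biUnion fun ij =>
        (ofSize ij.1 ×ˢ ofSize ij.2).image fun AB => join AB.1 AB.2) := by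
    rw [Finset.disjoint_left]
    intro c hc hc'
    split_ifs at hc
    · rw [Finset.mem_singleton] at hc
      subst hc
      simp at hc'
    · simp at hc
  have hU : ofSize n = (if n = 1 then {edge} else ∅ : Finset FinTree) ∪
      ((Finset.HasAntidiagonal.antidiagonal n).biUnion fun ij =>
        (ofSize ij.1 ×ˢ ofSize ij.2).image fun AB => join AB.1 AB.2) := by
    ext c
    rw [mem_ofSize, Finset.mem_union, Finset.mem_biUnion]
    cases c with
    | edge =>
      simp only [size, Finset.mem_image, Finset.mem_product, reduceCtorEq, and_false, exists_false,
        or_false]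
      split_ifs with h
      · simp [h]
      · simp [Ne.symm h]
    | join A B =>
      have : FinTree.join A B ∉ (if n = 1 then {edge} else ∅ : Finset FinTree) := by
        split_ifs <;> simp
      simp only [this, false_or, size, Finset.mem_image, Finset.mem_product, mem_ofSize,
        Finset.HasAntidiagonal.mem_antidiagonal]
      constructor
      · exact fun h => ⟨(A.size, B.size), h, (A, B), ⟨rfl, rfl⟩, rfl⟩
      · rintro ⟨ij, h, ⟨A', B'⟩, ⟨h1, h2⟩, h3⟩
        cases h3
        simpa [h1, h2] using h
  rw [hU, Finset.sum_union hdis]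
  congr 1
  · split_ifs <;> simp
  · rw [Finset.sum_biUnion]
    · refine Finset.sum_congr rfl fun ij _ => ?_
      rw [Finset.sum_image, Finset.sum_product]
      rintro ⟨A, B⟩ - ⟨A', B'⟩ - h
      cases h
      rfl
    · intro ij _ kl _ hne
      simp only [Function.onFun, Finset.disjoint_left, Finset.mem_image, Finset.mem_product,
        mem_ofSize]
      rintro c ⟨⟨A, B⟩, ⟨h1, h2⟩, rfl⟩ ⟨⟨A', B'⟩, ⟨h3, h4⟩, h5⟩
      cases h5
      exact hne (Prod.ext (h1.symm.trans h3) (h2.symm.trans h4))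

theorem tsum_eq_sum_ofSize (F : FinTree → ENNReal) :
    ∑' c, F c = ∑' n, ∑ c ∈ ofSize n, F c := by
  classical
  have h : ∀ n, ∑ c ∈ ofSize n, F c = ∑' c, if c.size = n then F c else 0 := fun n => by
    rw [tsum_eq_sum (s := ofSize n) fun c hc => by
      rw [mem_ofSize] at hc; rw [if_neg hc]]
    exact Finset.sum_congr rfl fun c hc => by rw [if_pos (mem_ofSize.1 hc)]
  simp_rw [h]
  rw [ENNReal.tsum_comm]
  exact tsum_congr fun c => (tsum_ite_eq' c.size fun _ => F c).symm

/-- A finite tree is a single edge or a pair of finite trees. -/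
def equivSum : Unit ⊕ FinTree × FinTree ≃ FinTree where
  toFun := Sum.elim (fun _ => edge) fun AB => join AB.1 AB.2
  invFun
    | edge => Sum.inl ()
    | join A B => Sum.inr (A, B)
  left_inv := by rintro (_ | ⟨A, B⟩) <;> rfl
  right_inv := by rintro (_ | ⟨A, B⟩) <;> rfl

theorem tsum_eq_edge_add (F : FinTree → ENNReal) :
    ∑' c, F c = F edge + ∑' A, ∑' B, F (join A B) := by
  rw [← equivSum.tsum_eq, ENNReal.summable.tsum_sum ENNReal.summable, ENNReal.tsum_prod']
  simp [equivSum]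

/-- The codes of the one-sided trees with `n` edges. -/
noncomputable def oneSidedOfSize (n : ℕ) : Finset FinTree := (ofSize n).filter OneSided

theorem mem_oneSidedOfSize {n : ℕ} {c : FinTree} :
    c ∈ oneSidedOfSize n ↔ c.size = n ∧ c.OneSided := by
  simp [oneSidedOfSize]

theorem toTree_mem_Omega {n : ℕ} {c : FinTree} :
    c.toTree ∈ PlanarTree.Omega n ↔ c ∈ oneSidedOfSize n := by
  simp only [PlanarTree.Omega, Set.mem_ofPred_eq, oneSided_toTree, isFin_toTree, size_toTree,
    mem_oneSidedOfSize, true_and]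
  tauto

/-- The one-sided trees with `n` edges and their codes. -/
noncomputable def equivOmega (n : ℕ) : oneSidedOfSize n ≃ PlanarTree.Omega n :=
  Equiv.ofBijective (fun c => ⟨c.1.toTree, toTree_mem_Omega.2 c.2⟩) (by
    constructor
    · exact fun c c' h => Subtype.ext (toTree_injective (Subtype.ext_iff.1 h))
    · rintro ⟨T, hT⟩
      obtain ⟨c, rfl⟩ := range_toTree.ge hT.2.1
      exact ⟨⟨c, toTree_mem_Omega.1 hT⟩, rfl⟩)

theorem numOmega_eq (m n : ℕ) :
    PlanarTree.numOmega m n = ((oneSidedOfSize n).filter fun c => c.height = m).card := by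
  have h : {T | T ∈ PlanarTree.Omega n ∧ T.height = m} =
      toTree '' ((oneSidedOfSize n).filter fun c => c.height = m : Finset FinTree) := by
    ext T
    constructor
    · rintro ⟨hT, hm⟩
      obtain ⟨c, rfl⟩ := range_toTree.ge hT.2.1
      rw [height_toTree, Nat.cast_inj] at hm
      exact ⟨c, by simpa [hm] using toTree_mem_Omega.1 hT, rfl⟩
    · rintro ⟨c, hc, rfl⟩
      rw [Finset.mem_coe, Finset.mem_filter] at hc
      exact ⟨toTree_mem_Omega.2 hc.1, by rw [height_toTree, hc.2]⟩
  rw [PlanarTree.numOmega, h, Set.ncard_image_of_injective _ toTree_injective,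
    Set.ncard_coe_finset]

theorem partitionFn_eq (μ : ℝ) (n : ℕ) :
    PlanarTree.partitionFn μ n = ∑ c ∈ oneSidedOfSize n, Real.exp (-μ * (c.height : ℝ)) := by
  have h : ∀ c ∈ oneSidedOfSize n, HasSum
      (fun m : ℕ => if m = c.height - 1 then Real.exp (-μ * ((m + 1 : ℕ) : ℝ)) else 0)
      (Real.exp (-μ * (c.height : ℝ))) := by
    intro c _
    have := hasSum_ite_eq (c.height - 1) (Real.exp (-μ * (c.height : ℝ)))
    convert this using 2 with m
    have := height_pos c
    split_ifs with hm
    · rw [hm, Nat.sub_add_cancel this]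
    · rfl
  refine Eq.trans (tsum_congr fun m => ?_) (hasSum_sum h).tsum_eq
  rw [numOmega_eq, ← Finset.sum_filter, Finset.sum_const, nsmul_eq_mul, mul_comm]
  congr 3
  refine Finset.filter_congr fun c _ => ?_
  have := height_pos c
  omega

end FinTree

/-! ### Exact height distributions of the BGW tree and of the one-sided trees. -/

namespace FinTree

open scoped ENNReal

/-- The probability of a finite tree under the BGW law with offspring probabilities
`x ^ n * (1 - x)`. -/
noncomputable def mass (x : ℝ) (c : FinTree) : ℝ := (x * (1 - x)) ^ c.size / x

/-- The weight of a one-sided tree: the mass of its branches along the leftmost path. -/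
noncomputable def spineMass (x : ℝ) (c : FinTree) : ℝ :=
  if c.OneSided then (x ^ c.height)⁻¹ * (x * (1 - x)) ^ c.size else 0

/-- The probability that the BGW tree with offspring probabilities `x ^ n * (1 - x)` has height at
most `k`. -/
noncomputable def heightProb (x : ℝ) (k : ℕ) : ℝ :=
  (1 - (x / (1 - x)) ^ k) / (1 - (x / (1 - x)) ^ (k + 1))

/-- The total weight of the one-sided trees of height `k ≥ 1`. -/
noncomputable def spineProb (x : ℝ) (k : ℕ) : ℝ :=
  (1 - x / (1 - x)) / (1 - (x / (1 - x)) ^ (k + 1))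

theorem tsum_tsum_mul (u v : FinTree → ℝ≥0∞) :
    ∑' A, ∑' B, u A * v B = (∑' A, u A) * ∑' B, v B := by
  simp_rw [ENNReal.tsum_mul_left, ENNReal.tsum_mul_right]

theorem mass_pos {x : ℝ} (hx0 : 0 < x) (hx : x < 1 / 2) (c : FinTree) : 0 < mass x c := by
  have : 0 < 1 - x := by linarith
  unfold mass; positivity

theorem mass_edge {x : ℝ} (hx0 : 0 < x) : mass x edge = 1 - x := by
  simp only [mass, size]; field_simp

theorem mass_join {x : ℝ} (hx0 : 0 < x) (A B : FinTree) :
    mass x (join A B) = x * mass x A * mass x B := by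
  simp only [mass, size, pow_add]; field_simp

theorem spineMass_nonneg {x : ℝ} (hx0 : 0 < x) (hx : x < 1 / 2) (c : FinTree) :
    0 ≤ spineMass x c := by
  have : 0 < 1 - x := by linarith
  unfold spineMass
  split_ifs <;> positivity

theorem spineMass_edge {x : ℝ} (hx0 : 0 < x) : spineMass x edge = 1 - x := by
  rw [spineMass, if_pos oneSided_edge]
  simp only [size, height]; field_simp

/-- The additional level contributes `1/x`, which completes the power with exponent `|B|` to `mass x
B`; the indicator is the height condition of `oneSided_join`. -/
theorem spineMass_join {x : ℝ} (hx0 : 0 < x) (A B : FinTree) : spineMass x (join A B) =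
    spineMass x A * (if B.height ≤ A.height + 1 then mass x B else 0) := by
  by_cases h : (join A B).OneSided
  · obtain ⟨h1, h2⟩ := oneSided_join.1 h
    rw [spineMass, if_pos h, height_join_of_oneSided h, spineMass, if_pos h1, if_pos h2, mass, size,
      pow_add _ A.size, pow_succ]
    generalize (x * (1 - x)) ^ A.size = a
    generalize (x * (1 - x)) ^ B.size = b
    field_simp
  · rw [spineMass, if_neg h]
    rw [oneSided_join, not_and_or] at h
    rcases h with h | h
    · rw [spineMass, if_neg h, zero_mul]
    · rw [if_neg h, mul_zero]

/-- Both parts of a join with at most `n + 1` edges have at most `n` edges, so the masses `S n` of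
the trees of size at most `n` satisfy `S (n+1) ≤ (1-x) + x (S n)²`, which preserves the bound `1`.
-/
theorem tsum_mass_le {x : ℝ} (hx0 : 0 < x) (hx : x < 1 / 2) :
    ∑' c, ENNReal.ofReal (mass x c) ≤ 1 := by
  have key : ∀ n : ℕ, ∑' c, (if c.size ≤ n then ENNReal.ofReal (mass x c) else 0) ≤ 1 := by
    intro n
    induction n with
    | zero =>
      refine le_of_eq_of_le (ENNReal.tsum_eq_zero.2 fun c => if_neg ?_) zero_le_one
      have := size_pos c
      omega
    | succ n ih =>
      rw [tsum_eq_edge_add]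
      have h1 : ∀ A B : FinTree,
          (if (join A B).size ≤ n + 1 then ENNReal.ofReal (mass x (join A B)) else 0) ≤
          ENNReal.ofReal x * (if A.size ≤ n then ENNReal.ofReal (mass x A) else 0) *
            (if B.size ≤ n then ENNReal.ofReal (mass x B) else 0) := by
        intro A B
        have := size_pos A
        have := size_pos B
        split_ifs with h h2 h3 h3
        · rw [mass_join hx0, ENNReal.ofReal_mul (by have := mass_pos hx0 hx A; positivity),
            ENNReal.ofReal_mul hx0.le]
        all_goals first | (exfalso; simp only [size] at h; omega) | exact zero_le
      calc _ ≤ ENNReal.ofReal (1 - x) + ∑' A, ∑' B, ENNReal.ofReal x *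
            (if A.size ≤ n then ENNReal.ofReal (mass x A) else 0) *
            (if B.size ≤ n then ENNReal.ofReal (mass x B) else 0) := by
            gcongr with A B
            · split_ifs
              · rw [mass_edge hx0]
              · exact zero_le
            · exact h1 A B
        _ ≤ ENNReal.ofReal (1 - x) + ENNReal.ofReal x * 1 * 1 := by
            rw [tsum_tsum_mul, ENNReal.tsum_mul_left]
            gcongr
        _ = 1 := by
            rw [mul_one, mul_one, ← ENNReal.ofReal_add (by linarith) hx0.le]
            simp
  rw [ENNReal.tsum_eq_iSup_sum]
  refine iSup_le fun s => le_trans ?_ (key (s.sup size))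
  refine le_trans (Finset.sum_le_sum fun c hc => ?_) (ENNReal.sum_le_tsum s)
  rw [if_pos (Finset.le_sup hc)]

/-- Solves the linear recursion for the probability of height at most `k + 1`. The bound `t ≤ 1` is
there to exclude the solution `∞`. -/
theorem eq_ofReal_of_eq {x : ℝ} (hx0 : 0 < x) (hx : x < 1 / 2) {t : ℝ≥0∞} {k : ℕ} (ht : t ≤ 1)
    (h : t = ENNReal.ofReal (1 - x) + ENNReal.ofReal (x * heightProb x k) * t) :
    t = ENNReal.ofReal (heightProb x (k + 1)) := by
  have h1x : 0 < 1 - x := by linarith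
  have hθ0 : 0 < x / (1 - x) := by positivity
  have hθ1 : x / (1 - x) < 1 := by rw [div_lt_one h1x]; linarith
  have hp : ∀ n : ℕ, (x / (1 - x)) ^ (n + 1) < 1 := fun n => pow_lt_one₀ hθ0.le hθ1 (by omega)
  have hpk : (x / (1 - x)) ^ k ≤ 1 := pow_le_one₀ hθ0.le hθ1.le
  have hφ : 0 ≤ heightProb x k := div_nonneg (by linarith) (by linarith [hp k])
  have ht' : t ≠ ∞ := ne_top_of_le_ne_top ENNReal.one_ne_top ht
  rw [← ENNReal.ofReal_toReal ht']
  congr 1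
  have h2 := congrArg ENNReal.toReal h
  rw [ENNReal.toReal_add ENNReal.ofReal_ne_top (ENNReal.mul_ne_top ENNReal.ofReal_ne_top ht'),
    ENNReal.toReal_mul, ENNReal.toReal_ofReal h1x.le, ENNReal.toReal_ofReal (by positivity)] at h2
  have d1 := hp k
  have d2 := hp (k + 1)
  -- Expressing `x` through `θ = x/(1-x)` makes the claim a rational identity in `θ` and its powers.
  have hxθ : x = (x / (1 - x)) / (1 + x / (1 - x)) := by field_simp; ring
  unfold heightProb at h2 ⊢
  generalize x / (1 - x) = θ at *
  subst hxθ
  have e1 : 1 - θ ^ (k + 1) ≠ 0 := by linarith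
  have e2 : 1 - θ ^ (k + 1 + 1) ≠ 0 := by linarith
  rw [eq_div_iff e2]
  field_simp at h2
  have e3 : t.toReal * (1 - θ ^ (k + 1 + 1)) = 1 - θ ^ (k + 1) := by
    rw [pow_succ θ (k + 1), pow_succ θ k]
    linear_combination h2
  exact e3

theorem heightProb_zero (x : ℝ) : heightProb x 0 = 0 := by simp [heightProb]

theorem heightProb_nonneg {x : ℝ} (hx0 : 0 < x) (hx : x < 1 / 2) (k : ℕ) : 0 ≤ heightProb x k := by
  have h1x : 0 < 1 - x := by linarith
  have hθ0 : 0 < x / (1 - x) := by positivity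
  have hθ1 : x / (1 - x) < 1 := by rw [div_lt_one h1x]; linarith
  exact div_nonneg (by linarith [pow_le_one₀ (n := k) hθ0.le hθ1.le])
    (by linarith [pow_le_one₀ (n := k + 1) hθ0.le hθ1.le])

/-- A join has height at most `k + 1` iff its parts have heights at most `k` and `k + 1`, so the
probabilities satisfy `φ (k+1) = (1-x) + x φ(k) φ(k+1)`. -/
theorem tsum_mass_height {x : ℝ} (hx0 : 0 < x) (hx : x < 1 / 2) (k : ℕ) :
    ∑' c, (if c.height ≤ k then ENNReal.ofReal (mass x c) else 0) =
      ENNReal.ofReal (heightProb x k) := by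
  induction k with
  | zero =>
    rw [heightProb_zero, ENNReal.ofReal_zero]
    refine ENNReal.tsum_eq_zero.2 fun c => if_neg ?_
    have := height_pos c
    omega
  | succ k ih =>
    apply eq_ofReal_of_eq hx0 hx
    · refine le_trans (ENNReal.tsum_le_tsum fun c => ?_) (tsum_mass_le hx0 hx)
      split_ifs
      · exact le_rfl
      · exact zero_le
    · conv_lhs => rw [tsum_eq_edge_add]
      have h1 : ∀ A B : FinTree,
          (if (join A B).height ≤ k + 1 then ENNReal.ofReal (mass x (join A B)) else 0) =
          ENNReal.ofReal x * (if A.height ≤ k then ENNReal.ofReal (mass x A) else 0) *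
            (if B.height ≤ k + 1 then ENNReal.ofReal (mass x B) else 0) := by
        intro A B
        have h : (join A B).height ≤ k + 1 ↔ A.height ≤ k ∧ B.height ≤ k + 1 := by
          simp only [height]; omega
        by_cases hA : A.height ≤ k <;> by_cases hB : B.height ≤ k + 1 <;> simp only [h, hA, hB]
        · simp only [and_self, if_true]
          rw [mass_join hx0, ENNReal.ofReal_mul (by have := mass_pos hx0 hx A; positivity),
            ENNReal.ofReal_mul hx0.le]
        all_goals simp
      simp_rw [h1]
      rw [tsum_tsum_mul, ENNReal.tsum_mul_left, ih, ENNReal.ofReal_mul hx0.le,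
        if_pos (by simp [height]), mass_edge hx0]

theorem tendsto_heightProb {x : ℝ} (hx0 : 0 < x) (hx : x < 1 / 2) :
    Tendsto (heightProb x) atTop (𝓝 1) := by
  have h1x : 0 < 1 - x := by linarith
  have hθ0 : 0 < x / (1 - x) := by positivity
  have hθ1 : x / (1 - x) < 1 := by rw [div_lt_one h1x]; linarith
  have h := tendsto_pow_atTop_nhds_zero_of_lt_one hθ0.le hθ1
  have h2 : Tendsto (heightProb x) atTop _ :=
    ((h.const_sub 1).div ((h.comp (tendsto_add_atTop_nat 1)).const_sub 1) (by simp))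
  simpa using h2

/-- Extinction: the total mass is bounded below by the probabilities of bounded height, which tend
to `1` because `θ < 1`. -/
theorem tsum_mass {x : ℝ} (hx0 : 0 < x) (hx : x < 1 / 2) : ∑' c, ENNReal.ofReal (mass x c) = 1 := by
  refine le_antisymm (tsum_mass_le hx0 hx) ?_
  have h : Tendsto (fun k => ENNReal.ofReal (heightProb x k)) atTop (𝓝 1) := by
    simpa using ENNReal.tendsto_ofReal (tendsto_heightProb hx0 hx)
  refine le_of_tendsto' h fun k => ?_
  rw [← tsum_mass_height hx0 hx]
  refine ENNReal.tsum_le_tsum fun c => ?_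
  split_ifs
  · exact le_rfl
  · exact zero_le

theorem heightProb_le_one {x : ℝ} (hx0 : 0 < x) (hx : x < 1 / 2) (k : ℕ) :
    heightProb x k ≤ 1 := by
  rw [← ENNReal.ofReal_le_one, ← tsum_mass_height hx0 hx, ← tsum_mass hx0 hx]
  refine ENNReal.tsum_le_tsum fun c => ?_
  split_ifs
  · exact le_rfl
  · exact zero_le

theorem tsum_mass_height_gt {x : ℝ} (hx0 : 0 < x) (hx : x < 1 / 2) (k : ℕ) :
    ∑' c, (if k < c.height then ENNReal.ofReal (mass x c) else 0) =
      ENNReal.ofReal (1 - heightProb x k) := by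
  have h : ∑' c, (if c.height ≤ k then ENNReal.ofReal (mass x c) else 0) +
      ∑' c, (if k < c.height then ENNReal.ofReal (mass x c) else 0) = 1 := by
    rw [← ENNReal.tsum_add, ← tsum_mass hx0 hx]
    refine tsum_congr fun c => ?_
    by_cases h : c.height ≤ k
    · rw [if_pos h, if_neg (by omega), add_zero]
    · rw [if_neg h, if_pos (by omega), zero_add]
  rw [tsum_mass_height hx0 hx] at h
  rw [ENNReal.ofReal_sub _ (heightProb_nonneg hx0 hx k), ENNReal.ofReal_one, ← h,
    ENNReal.add_sub_cancel_left ENNReal.ofReal_ne_top]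

theorem spineProb_one {x : ℝ} (hx0 : 0 < x) (hx : x < 1 / 2) : spineProb x 1 = 1 - x := by
  have h1x : 0 < 1 - x := by linarith
  have hθ0 : 0 < x / (1 - x) := by positivity
  have hθ1 : x / (1 - x) < 1 := by rw [div_lt_one h1x]; linarith
  have h2 := pow_lt_one₀ (n := 1 + 1) hθ0.le hθ1 (by omega)
  have hxθ : 1 - x = 1 / (1 + x / (1 - x)) := by field_simp; ring
  rw [spineProb, div_eq_iff (by linarith)]
  generalize x / (1 - x) = θ at *
  rw [hxθ]
  field_simp
  ring

/-- Thus `spineProb x k` is the telescoping product of the height probabilities: the branch at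
distance `k - j` from the end of the path must have height at most `j + 1`. -/
theorem spineProb_succ {x : ℝ} (hx0 : 0 < x) (hx : x < 1 / 2) (k : ℕ) :
    spineProb x (k + 1) = spineProb x k * heightProb x (k + 1) := by
  have h1x : 0 < 1 - x := by linarith
  have hθ0 : 0 < x / (1 - x) := by positivity
  have hθ1 : x / (1 - x) < 1 := by rw [div_lt_one h1x]; linarith
  have := pow_lt_one₀ (n := k + 1) hθ0.le hθ1 (by omega)
  rw [spineProb, spineProb, heightProb, div_mul_div_cancel₀ (by linarith)]

theorem spineProb_pos {x : ℝ} (hx0 : 0 < x) (hx : x < 1 / 2) (k : ℕ) : 0 < spineProb x k := by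
  have h1x : 0 < 1 - x := by linarith
  have hθ0 : 0 < x / (1 - x) := by positivity
  have hθ1 : x / (1 - x) < 1 := by rw [div_lt_one h1x]; linarith
  have := pow_lt_one₀ (n := k + 1) hθ0.le hθ1 (by omega)
  exact div_pos (by linarith) (by linarith)

/-- A one-sided tree of height `k + 2` is a one-sided `A` of height `k + 1` with an arbitrary first
branch of height at most `k + 2`. -/
theorem tsum_spineMass_height {x : ℝ} (hx0 : 0 < x) (hx : x < 1 / 2) (k : ℕ) :
    ∑' c, (if c.height = k + 1 then ENNReal.ofReal (spineMass x c) else 0) =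
      ENNReal.ofReal (spineProb x (k + 1)) := by
  induction k with
  | zero =>
    rw [tsum_eq_edge_add, if_pos (by simp [height]), spineMass_edge hx0, spineProb_one hx0 hx]
    convert add_zero _
    refine ENNReal.tsum_eq_zero.2 fun A => ENNReal.tsum_eq_zero.2 fun B => if_neg ?_
    have := height_pos A
    simp only [height]
    omega
  | succ k ih =>
    rw [tsum_eq_edge_add, if_neg (by simp [height]), zero_add]
    have h1 : ∀ A B : FinTree,
        (if (join A B).height = k + 1 + 1 then ENNReal.ofReal (spineMass x (join A B)) else 0) =
        (if A.height = k + 1 then ENNReal.ofReal (spineMass x A) else 0) *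
          (if B.height ≤ k + 1 + 1 then ENNReal.ofReal (mass x B) else 0) := by
      intro A B
      rw [spineMass_join hx0, ENNReal.ofReal_mul (spineMass_nonneg hx0 hx A)]
      by_cases hA : A.height = k + 1 <;> by_cases hB : B.height ≤ k + 1 + 1
      · have : (join A B).height = k + 1 + 1 := by simp only [height]; omega
        simp only [this, hA, hB, if_true]
      · simp [hA, hB]
      · by_cases hB' : B.height ≤ A.height + 1
        · have : ¬ (join A B).height = k + 1 + 1 := by simp only [height]; omega
          simp only [this, hA, if_false, zero_mul]
        · simp [hA, hB']
      · by_cases hB' : B.height ≤ A.height + 1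
        · have : ¬ (join A B).height = k + 1 + 1 := by simp only [height]; omega
          simp only [this, hA, if_false, zero_mul]
        · simp [hA, hB']
    simp_rw [h1]
    rw [tsum_tsum_mul, ih, tsum_mass_height hx0 hx, spineProb_succ hx0 hx (k + 1),
      ENNReal.ofReal_mul (spineProb_pos hx0 hx _).le]

theorem tendsto_spineProb {x : ℝ} (hx0 : 0 < x) (hx : x < 1 / 2) :
    Tendsto (spineProb x) atTop (𝓝 (1 - x / (1 - x))) := by
  have h1x : 0 < 1 - x := by linarith
  have hθ0 : 0 < x / (1 - x) := by positivity
  have hθ1 : x / (1 - x) < 1 := by rw [div_lt_one h1x]; linarith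
  have h := tendsto_pow_atTop_nhds_zero_of_lt_one hθ0.le hθ1
  have h2 : Tendsto (spineProb x) atTop _ := ((tendsto_const_nhds (x := 1 - x / (1 - x))).div
    ((h.comp (tendsto_add_atTop_nat 1)).const_sub 1) (by simp))
  simpa using h2

end FinTree

/-! ### Asymptotics of the weighted number of one-sided trees. -/

namespace FinTree

open scoped ENNReal

/-- The weighted number of one-sided trees with `n` edges. -/
noncomputable def spineCoeff (x : ℝ) (n : ℕ) : ℝ := ∑ c ∈ ofSize n, spineMass x c

/-- The probability that the BGW tree has `n` edges. -/
noncomputable def sizeProb (x : ℝ) (n : ℕ) : ℝ := ∑ c ∈ ofSize n, mass x c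

/-- The weight of the pairs of trees that are not the two parts of a one-sided tree. -/
noncomputable def defectMass (x : ℝ) : FinTree → ℝ
  | edge => 0
  | join A B => spineMass x A * (if A.height + 1 < B.height then mass x B else 0)

/-- The total defect of the pairs with `n` edges. -/
noncomputable def defectCoeff (x : ℝ) (n : ℕ) : ℝ := ∑ c ∈ ofSize n, defectMass x c

theorem hasSum_sum_ofSize {W : FinTree → ℝ} (hW : ∀ c, 0 ≤ W c) {S : ℝ} (hS : 0 ≤ S)
    (h : ∑' c, ENNReal.ofReal (W c) = ENNReal.ofReal S) :
    HasSum (fun n => ∑ c ∈ ofSize n, W c) S := by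
  have h1 : ∑' n, ENNReal.ofReal (∑ c ∈ ofSize n, W c) = ENNReal.ofReal S := by
    rw [← h, tsum_eq_sum_ofSize]
    exact tsum_congr fun n => ENNReal.ofReal_sum_of_nonneg fun c _ => hW c
  have h2 := ENNReal.hasSum_toReal (h1 ▸ ENNReal.ofReal_ne_top)
  rw [← ENNReal.tsum_toReal_eq (fun _ => ENNReal.ofReal_ne_top), h1, ENNReal.toReal_ofReal hS] at h2
  convert h2 using 2 with n
  rw [ENNReal.toReal_ofReal (Finset.sum_nonneg fun c _ => hW c)]

theorem hasSum_sizeProb {x : ℝ} (hx0 : 0 < x) (hx : x < 1 / 2) : HasSum (sizeProb x) 1 :=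
  hasSum_sum_ofSize (fun c => (mass_pos hx0 hx c).le) zero_le_one
    (by rw [tsum_mass hx0 hx, ENNReal.ofReal_one])

theorem defectMass_nonneg {x : ℝ} (hx0 : 0 < x) (hx : x < 1 / 2) : ∀ c, 0 ≤ defectMass x c
  | edge => le_rfl
  | join A B => by
    have := (mass_pos hx0 hx B).le
    refine mul_nonneg (spineMass_nonneg hx0 hx A) ?_
    split_ifs <;> simp [this]

theorem tsum_height_eq (F : FinTree → ℝ≥0∞) :
    ∑' c, F c = ∑' k : ℕ, ∑' c, if c.height = k + 1 then F c else 0 := by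
  rw [ENNReal.tsum_comm]
  refine tsum_congr fun c => ?_
  refine (tsum_ite_eq (c.height - 1) fun _ => F c).symm.trans ?_
  refine tsum_congr fun k => ?_
  have := height_pos c
  congr 1
  rw [eq_iff_iff]
  omega

/-- By `spineProb_succ` the terms are differences of consecutive values of `spineProb`, whose limit
is `1 - θ`. -/
theorem hasSum_spineProb_sub {x : ℝ} (hx0 : 0 < x) (hx : x < 1 / 2) :
    HasSum (fun k => spineProb x (k + 1) * (1 - heightProb x (k + 1 + 1)))
      (1 - x - (1 - x / (1 - x))) := by
  have h0 : ∀ k, spineProb x (k + 1) * (1 - heightProb x (k + 1 + 1)) =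
      spineProb x (k + 1) - spineProb x (k + 1 + 1) := fun k => by
    rw [spineProb_succ hx0 hx (k + 1)]; ring
  rw [hasSum_iff_tendsto_nat_of_nonneg]
  · simp_rw [h0, Finset.sum_range_sub' (fun k => spineProb x (k + 1))]
    rw [zero_add, spineProb_one hx0 hx]
    exact ((tendsto_spineProb hx0 hx).comp (tendsto_add_atTop_nat 1)).const_sub _
  · intro k
    refine mul_nonneg (spineProb_pos hx0 hx _).le ?_
    exact sub_nonneg.2 (heightProb_le_one hx0 hx _)

/-- Sorting the defective pairs by the height of `A` leaves, for each height, the weight of `A`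
times the probability that `B` is too high. -/
theorem hasSum_defectCoeff {x : ℝ} (hx0 : 0 < x) (hx : x < 1 / 2) :
    HasSum (defectCoeff x) (1 - x - (1 - x / (1 - x))) := by
  have hS := hasSum_spineProb_sub hx0 hx
  have hnn2 : ∀ k, 0 ≤ spineProb x (k + 1) * (1 - heightProb x (k + 1 + 1)) := fun k =>
    mul_nonneg (spineProb_pos hx0 hx _).le (sub_nonneg.2 (heightProb_le_one hx0 hx _))
  refine hasSum_sum_ofSize (defectMass_nonneg hx0 hx) (hS.nonneg hnn2) ?_
  rw [← hS.tsum_eq, ENNReal.ofReal_tsum_of_nonneg hnn2 hS.summable, tsum_eq_edge_add, defectMass,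
    ENNReal.ofReal_zero, zero_add, tsum_height_eq]
  refine tsum_congr fun k => ?_
  rw [ENNReal.ofReal_mul (spineProb_pos hx0 hx _).le, ← tsum_spineMass_height hx0 hx,
    ← ENNReal.tsum_mul_right]
  refine tsum_congr fun A => ?_
  split_ifs with hA
  · rw [← tsum_mass_height_gt hx0 hx, ← ENNReal.tsum_mul_left]
    refine tsum_congr fun B => ?_
    rw [defectMass, ENNReal.ofReal_mul (spineMass_nonneg hx0 hx A), hA]
    congr 1
    split_ifs <;> simp
  · rw [zero_mul]

open PowerSeries in
theorem sizeProb_series {x : ℝ} (hx0 : 0 < x) : (PowerSeries.mk (sizeProb x) : ℝ⟦X⟧) =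
    C (1 - x) * X + C x * (PowerSeries.mk (sizeProb x) * PowerSeries.mk (sizeProb x)) := by
  ext n
  rw [coeff_mk, map_add, coeff_C_mul, coeff_C_mul, coeff_X, coeff_mul, sizeProb, sum_ofSize,
    mass_edge hx0, mul_ite, mul_one, mul_zero, Finset.mul_sum]
  congr 1
  refine Finset.sum_congr rfl fun ij _ => ?_
  rw [coeff_mk, coeff_mk, sizeProb, sizeProb, Finset.sum_mul_sum, Finset.mul_sum]
  refine Finset.sum_congr rfl fun A _ => ?_
  rw [Finset.mul_sum]
  exact Finset.sum_congr rfl fun B _ => by rw [mass_join hx0]; ring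

-- Without the height constraint the equation would be `A = (1-x)z + AF`; the defect series restores
-- the constraint and, unlike `A`, is summable at `z = 1`.
open PowerSeries in
theorem spineCoeff_series {x : ℝ} (hx0 : 0 < x) :
    (PowerSeries.mk (spineCoeff x) : ℝ⟦X⟧) =
      C (1 - x) * X + PowerSeries.mk (spineCoeff x) * PowerSeries.mk (sizeProb x) -
        PowerSeries.mk (defectCoeff x) := by
  rw [eq_sub_iff_add_eq]
  ext n
  rw [map_add, map_add, coeff_mk, coeff_mk, coeff_C_mul, coeff_X, coeff_mul, spineCoeff,
    defectCoeff, ← Finset.sum_add_distrib, sum_ofSize, spineMass_edge hx0, defectMass, add_zero,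
    mul_ite, mul_one, mul_zero]
  congr 1
  refine Finset.sum_congr rfl fun ij _ => ?_
  rw [coeff_mk, coeff_mk, spineCoeff, sizeProb, Finset.sum_mul_sum]
  refine Finset.sum_congr rfl fun A _ => Finset.sum_congr rfl fun B _ => ?_
  rw [spineMass_join hx0, defectMass, ← mul_add]
  by_cases h : B.height ≤ A.height + 1
  · rw [if_pos h, if_neg (by omega), add_zero]
  · rw [if_neg h, if_pos (by omega), zero_add]

/-- The limit of the weighted numbers of one-sided trees. -/
noncomputable def spineLimit (x : ℝ) : ℝ := (1 - x / (1 - x)) ^ 2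

theorem spineLimit_pos {x : ℝ} (hx0 : 0 < x) (hx : x < 1 / 2) : 0 < spineLimit x := by
  have h1x : 0 < 1 - x := by linarith
  have hθ1 : x / (1 - x) < 1 := by rw [div_lt_one h1x]; linarith
  exact pow_pos (by linarith) 2

-- The equations for `A` and `F` combine to `(1-x)(1-z)A = ((1-x)z - E)((1-x) - xF)`. The right side
-- is summable at `z = 1`, so the coefficients of `A` converge to its sum divided by `1-x`, namely
-- `(1-θ)(1-2x)/(1-x) = (1-θ)²`.
open PowerSeries in
theorem tendsto_spineCoeff {x : ℝ} (hx0 : 0 < x) (hx : x < 1 / 2) :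
    Tendsto (spineCoeff x) atTop (𝓝 (spineLimit x)) := by
  have h1x : 0 < 1 - x := by linarith
  -- `u` and `v` are the coefficients of `(1-x)z - E` and of `(1-x) - xF`.
  set u : ℕ → ℝ := fun n => (if n = 1 then 1 - x else 0) - defectCoeff x n
  set v : ℕ → ℝ := fun n => (if n = 0 then 1 - x else 0) - x * sizeProb x n
  have hu : HasSum u (1 - x - (1 - x - (1 - x / (1 - x)))) :=
    (hasSum_ite_eq 1 (1 - x)).sub (hasSum_defectCoeff hx0 hx)
  have hv : HasSum v (1 - x - x * 1) :=
    (hasSum_ite_eq 0 (1 - x)).sub ((hasSum_sizeProb hx0 hx).mul_left x)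
  have hH : HasSum (fun n => ∑ kl ∈ Finset.HasAntidiagonal.antidiagonal n, u kl.1 * v kl.2)
      ((1 - x - (1 - x - (1 - x / (1 - x)))) * (1 - x - x * 1)) := by
    rw [← hu.tsum_eq, ← hv.tsum_eq, tsum_mul_tsum_eq_tsum_sum_antidiagonal_of_summable_norm
      hu.summable.norm hv.summable.norm]
    exact (summable_norm_sum_mul_antidiagonal_of_summable_norm
      hu.summable.norm hv.summable.norm).of_norm.hasSum
  set P : ℝ⟦X⟧ := PowerSeries.mk u * PowerSeries.mk v with hP
  have hcoeff : ∀ n, coeff n P = ∑ kl ∈ Finset.HasAntidiagonal.antidiagonal n, u kl.1 * v kl.2 :=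
    fun n => by simp only [hP, coeff_mul, coeff_mk]
  have hmu : PowerSeries.mk u = C (1 - x) * X - PowerSeries.mk (defectCoeff x) := by
    ext n
    rw [map_sub, coeff_mk, coeff_mk, coeff_C_mul, coeff_X, mul_ite, mul_one, mul_zero]
  have hmv : PowerSeries.mk v = C (1 - x) - C x * PowerSeries.mk (sizeProb x) := by
    ext n
    rw [map_sub, coeff_mk, coeff_C_mul, coeff_C, coeff_mk]
  have hA : P = C (1 - x) * (PowerSeries.mk (spineCoeff x) - X * PowerSeries.mk (spineCoeff x)) := by
    have h1 := spineCoeff_series hx0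
    have h2 := sizeProb_series hx0
    rw [hP, hmu, hmv]
    have hC : (C (1 - x) : ℝ⟦X⟧) = 1 - C x := by simp
    generalize PowerSeries.mk (spineCoeff x) = A at *
    generalize PowerSeries.mk (sizeProb x) = F at *
    generalize PowerSeries.mk (defectCoeff x) = E at *
    generalize (C x : ℝ⟦X⟧) = c at *
    generalize (C (1 - x) : ℝ⟦X⟧) = d at *
    -- The equation `h1` reads `A(1-F) = (1-x)z - E`, and `h2` gives `(1-F)(1-x-xF) = (1-x)(1-z)`.
    linear_combination (-(d - c * F)) * h1 - A * h2 - A * F * hC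
  -- Dividing by `1-z` amounts to taking partial sums of coefficients.
  have hsum : ∀ n, ∑ k ∈ Finset.range (n + 1), coeff k P = (1 - x) * spineCoeff x n := by
    intro n
    induction n with
    | zero => rw [Finset.sum_range_one, hA, coeff_C_mul, map_sub, coeff_zero_X_mul, coeff_mk, sub_zero]
    | succ n ih =>
      rw [Finset.sum_range_succ, ih, hA, coeff_C_mul, map_sub, coeff_succ_X_mul, coeff_mk, coeff_mk]
      ring
  simp_rw [← hcoeff] at hH
  have h3 := (hH.tendsto_sum_nat.comp (tendsto_add_atTop_nat 1)).div_const (1 - x)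
  refine Tendsto.congr (fun n => ?_) (h3.trans (le_of_eq ?_))
  · simp only [Function.comp]
    rw [hsum, mul_div_cancel_left₀ _ h1x.ne']
  · congr 1
    rw [spineLimit]
    field_simp
    ring

/-- The one-sided trees of height at most `k` have finite total weight, so their contribution at
size `n` tends to `0`. -/
theorem tendsto_spineCoeff_height {x : ℝ} (hx0 : 0 < x) (hx : x < 1 / 2) (k : ℕ) :
    Tendsto (fun n => ∑ c ∈ (ofSize n).filter fun c => k < c.height, spineMass x c) atTop
      (𝓝 (spineLimit x)) := by
  have h1 : ∑' c, (if c.height ≤ k then ENNReal.ofReal (spineMass x c) else 0) =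
      ∑ j ∈ Finset.range k, ENNReal.ofReal (spineProb x (j + 1)) := by
    rw [tsum_height_eq, tsum_eq_sum (s := Finset.range k)]
    · refine Finset.sum_congr rfl fun j hj => ?_
      rw [← tsum_spineMass_height hx0 hx]
      refine tsum_congr fun c => ?_
      rw [Finset.mem_range] at hj
      by_cases h : c.height = j + 1
      · rw [if_pos h, if_pos h, if_pos (by omega)]
      · rw [if_neg h, if_neg h]
    · intro j hj
      rw [Finset.mem_range] at hj
      refine ENNReal.tsum_eq_zero.2 fun c => ?_
      by_cases h : c.height = j + 1
      · rw [if_pos h, if_neg (by omega)]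
      · rw [if_neg h]
  have hW : ∀ c, 0 ≤ (if c.height ≤ k then spineMass x c else 0) := fun c => by
    have := spineMass_nonneg hx0 hx c
    split_ifs <;> simp [this]
  have h2 := hasSum_sum_ofSize hW
    (S := ∑ j ∈ Finset.range k, spineProb x (j + 1))
    (Finset.sum_nonneg fun j _ => (spineProb_pos hx0 hx _).le) (by
      rw [ENNReal.ofReal_sum_of_nonneg fun j _ => (spineProb_pos hx0 hx _).le, ← h1]
      refine tsum_congr fun c => ?_
      split_ifs <;> simp)
  have h3 := (tendsto_spineCoeff hx0 hx).sub h2.summable.tendsto_atTop_zero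
  rw [sub_zero] at h3
  refine h3.congr fun n => ?_
  rw [spineCoeff, ← Finset.sum_sub_distrib, Finset.sum_filter]
  refine Finset.sum_congr rfl fun c _ => ?_
  by_cases h : c.height ≤ k
  · rw [if_pos h, if_neg (by omega), sub_self]
  · rw [if_neg h, if_pos (by omega), sub_zero]

/-! ### The critical point and the value of the tree generating function there. -/

theorem partitionFn_mul {x : ℝ} (hx0 : 0 < x) (n : ℕ) :
    PlanarTree.partitionFn (Real.log x) n * (x * (1 - x)) ^ n = spineCoeff x n := by
  rw [partitionFn_eq, spineCoeff, oneSidedOfSize, Finset.sum_filter, Finset.sum_mul]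
  refine Finset.sum_congr rfl fun c hc => ?_
  rw [mem_ofSize] at hc
  rw [spineMass]
  split_ifs
  · rw [hc, neg_mul, Real.exp_neg, mul_comm (Real.log x), Real.exp_nat_mul, Real.exp_log hx0]
  · rw [zero_mul]

/-- Ratio test: `W_n g^n` has a nonzero limit, so `W_n / W_(n+1)` tends to `g = x(1-x)`. -/
theorem gCrit_log {x : ℝ} (hx0 : 0 < x) (hx : x < 1 / 2) :
    PlanarTree.gCrit (Real.log x) = x * (1 - x) := by
  have hg : 0 < x * (1 - x) := mul_pos hx0 (by linarith)
  have hL := spineLimit_pos hx0 hx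
  have ht := tendsto_spineCoeff hx0 hx
  have h1 : Tendsto (fun n => x * (1 - x) * (spineCoeff x n / spineCoeff x (n + 1)))
      atTop (𝓝 (x * (1 - x))) := by
    have := (ht.div (ht.comp (tendsto_add_atTop_nat 1)) hL.ne').const_mul (x * (1 - x))
    rwa [div_self hL.ne', mul_one] at this
  have h2 : Tendsto (fun n => ‖PlanarTree.partitionFn (Real.log x) n‖ /
      ‖PlanarTree.partitionFn (Real.log x) n.succ‖) atTop
      (𝓝 ((⟨x * (1 - x), hg.le⟩ : NNReal) : ℝ)) := by
    refine h1.congr fun n => ?_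
    have h0 : ∀ n, 0 ≤ PlanarTree.partitionFn (Real.log x) n := fun n => by
      rw [partitionFn_eq]
      exact Finset.sum_nonneg fun c _ => (Real.exp_pos _).le
    rw [Real.norm_of_nonneg (h0 n), Real.norm_of_nonneg (h0 _), ← partitionFn_mul hx0,
      ← partitionFn_mul hx0, pow_succ, Nat.succ_eq_add_one]
    have h1x : 1 - x ≠ 0 := by linarith
    field_simp
  rw [PlanarTree.gCrit, FormalMultilinearSeries.ofScalars_radius_eq_of_tendsto ℝ _
    (r := ⟨x * (1 - x), hg.le⟩) (fun h => hg.ne' (congrArg NNReal.toReal h)) h2]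
  rfl

theorem genX_eq {x : ℝ} (hx0 : 0 < x) (hx : x < 1 / 2) :
    PlanarTree.genX (x * (1 - x)) = x := by
  let e : FinTree ≃ {T : PlanarTree // T.IsFin} :=
    Equiv.ofBijective (fun c => ⟨c.toTree, isFin_toTree c⟩)
      ⟨fun c c' h => toTree_injective (Subtype.ext_iff.1 h), fun T => by
        obtain ⟨c, hc⟩ := range_toTree.ge T.2
        exact ⟨c, Subtype.ext hc⟩⟩
  have h1 : ∑' c, mass x c = 1 := by
    have h := congrArg ENNReal.toReal (tsum_mass hx0 hx)
    rw [ENNReal.tsum_toReal_eq fun _ => ENNReal.ofReal_ne_top, ENNReal.toReal_one] at h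
    rw [← h]
    exact tsum_congr fun c => (ENNReal.toReal_ofReal (mass_pos hx0 hx c).le).symm
  rw [PlanarTree.genX, ← e.tsum_eq]
  have h2 : ∀ c, (x * (1 - x)) ^ (e c).1.size = x * mass x c := fun c => by
    rw [mass, mul_div_cancel₀ _ hx0.ne']
    exact congrArg _ (size_toTree c)
  simp_rw [h2]
  rw [tsum_mul_left, h1, mul_one]

end FinTree

/-! ### Topology and Borel structure of the space of trees. -/

namespace PlanarTree

/-- The subtree spanned by the vertices at distance at most `r + 1` from the root. -/
def truncTree (T : PlanarTree) (r : ℕ) : PlanarTree where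
  verts := T.trunc (r + 1)
  nil_mem := ⟨T.nil_mem, by simp⟩
  root_degree i := by simp [trunc, T.root_degree]
  parent_mem u i h := ⟨T.parent_mem u i h.1, by have := h.2; simp at this; omega⟩
  left_mem u i j h hj := ⟨T.left_mem u i j h.1 hj, by have := h.2; simp at this ⊢; omega⟩
  finite_offspring u := (T.finite_offspring u).subset fun _ h => h.1

theorem trunc_truncTree (T : PlanarTree) (r : ℕ) :
    (T.truncTree r).trunc (r + 1) = T.trunc (r + 1) :=
  trunc_eq_iff.2 fun _ hv => ⟨fun h => h.1, fun h => ⟨h, hv⟩⟩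

theorem isFin_truncTree (T : PlanarTree) (r : ℕ) : (T.truncTree r).IsFin := by
  refine ((Set.finite_le_nat (r + 1)).biUnion fun s _ => T.finite_level s).subset ?_
  rintro v ⟨hv, hl⟩
  exact Set.mem_biUnion (show v.length ∈ {i | i ≤ r + 1} from hl) ⟨hv, rfl⟩

theorem isOpen_setOf_trunc (T : PlanarTree) (r : ℕ) :
    IsOpen {T' : PlanarTree | T'.trunc (r + 1) = T.trunc (r + 1)} := by
  rw [Metric.isOpen_iff]
  intro T' hT'
  refine ⟨1 / ((r + 1 : ℕ) : ℝ), by positivity, fun T'' h => ?_⟩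
  have := (mem_closedBall_iff (by omega)).1 (Metric.ball_subset_closedBall h)
  exact this.trans hT'

theorem exists_trunc_subset {G : Set PlanarTree} (hG : IsOpen G) {T : PlanarTree} (hT : T ∈ G) :
    ∃ r, {T' : PlanarTree | T'.trunc (r + 1) = T.trunc (r + 1)} ⊆ G := by
  obtain ⟨ε, hε, h⟩ := Metric.isOpen_iff.1 hG T hT
  obtain ⟨r, hr⟩ := exists_nat_one_div_lt hε
  refine ⟨r, fun T' hT' => h ?_⟩
  rw [Metric.mem_ball]
  have := (mem_closedBall_iff (by omega)).2 hT'
  rw [Metric.mem_closedBall] at this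
  push_cast at this
  exact this.trans_lt hr

theorem isTopologicalBasis_trunc : TopologicalSpace.IsTopologicalBasis
    {S : Set PlanarTree | ∃ (T : PlanarTree) (r : ℕ),
      S = {T' | T'.trunc (r + 1) = T.trunc (r + 1)}} := by
  refine TopologicalSpace.isTopologicalBasis_of_isOpen_of_nhds ?_ ?_
  · rintro S ⟨T, r, rfl⟩
    exact isOpen_setOf_trunc T r
  · intro T G hT hG
    obtain ⟨r, hr⟩ := exists_trunc_subset hG hT
    exact ⟨_, ⟨T, r, rfl⟩, rfl, hr⟩

instance : TopologicalSpace.SeparableSpace PlanarTree := by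
  refine ⟨Set.range FinTree.toTree, Set.countable_range _, ?_⟩
  rw [isTopologicalBasis_trunc.dense_iff]
  rintro S ⟨T, r, rfl⟩ -
  rw [FinTree.range_toTree]
  exact ⟨T.truncTree r, trunc_truncTree T r, isFin_truncTree T r⟩

instance : SecondCountableTopology PlanarTree :=
  UniformSpace.secondCountable_of_separable PlanarTree

theorem borel_eq_generateFrom_trunc : borel PlanarTree =
    MeasurableSpace.generateFrom
      {S : Set PlanarTree | ∃ (T : PlanarTree) (r : ℕ),
      S = {T' | T'.trunc (r + 1) = T.trunc (r + 1)}} :=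
  isTopologicalBasis_trunc.borel_eq_generateFrom

/-- A ball is a countable intersection of conditions on single words, and the balls generate the
Borel sets. -/
theorem measurable_of_mem {α : Type*} [MeasurableSpace α] {f : α → PlanarTree}
    (h : ∀ i w, MeasurableSet {a | 0 :: i :: w ∈ (f a).verts}) : Measurable f := by
  change @Measurable _ _ _ (borel PlanarTree) f
  rw [borel_eq_generateFrom_trunc]
  refine measurable_generateFrom ?_
  rintro S ⟨T, r, rfl⟩
  have : f ⁻¹' {T' | T'.trunc (r + 1) = T.trunc (r + 1)} = ⋂ (i : ℕ) (w : List ℕ)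
      (_ : w.length + 2 ≤ r + 1), {a | 0 :: i :: w ∈ (f a).verts ↔ 0 :: i :: w ∈ T.verts} := by
    ext a
    simp only [Set.mem_preimage, Set.mem_ofPred_eq, trunc_eq_iff_cons, Set.mem_iInter]
  rw [this]
  refine MeasurableSet.iInter fun i => MeasurableSet.iInter fun w => MeasurableSet.iInter fun _ => ?_
  by_cases hT : 0 :: i :: w ∈ T.verts
  · simpa only [hT, iff_true] using h i w
  · simp only [hT, iff_false]
    exact (h i w).compl

theorem measurableSet_mem (v : List ℕ) : MeasurableSet {T : PlanarTree | v ∈ T.verts} := by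
  refine IsOpen.measurableSet (Metric.isOpen_iff.2 fun T hT => ?_)
  refine ⟨1 / ((v.length + 1 : ℕ) : ℝ), by positivity, fun T' h => ?_⟩
  have := (mem_closedBall_iff (by omega)).1 (Metric.ball_subset_closedBall h)
  exact ((trunc_eq_iff.1 this) v (by omega)).2 hT

theorem measurable_branch (s : ℕ) : Measurable (branch s) :=
  measurable_of_mem fun i w => by
    simp only [mem_branch]
    exact measurableSet_mem _

theorem measurable_join {α : Type*} [MeasurableSpace α] {f g : α → PlanarTree}
    (hf : Measurable f) (hg : Measurable g) : Measurable fun a => join (f a) (g a) :=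
  measurable_of_mem fun i w => by
    cases i with
    | zero =>
      simp only [mem_join_zero]
      exact hf (measurableSet_mem _)
    | succ i =>
      simp only [mem_join_succ]
      exact hg (measurableSet_mem _)

theorem isPiSystem_trunc : IsPiSystem
    {S : Set PlanarTree | ∃ (T : PlanarTree) (r : ℕ),
      S = {T' | T'.trunc (r + 1) = T.trunc (r + 1)}} := by
  rintro _ ⟨T, r, rfl⟩ _ ⟨T', r', rfl⟩ ⟨U, h1, h2⟩
  refine ⟨U, max r r', ?_⟩
  ext V
  have h1 : U.trunc (r + 1) = T.trunc (r + 1) := h1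
  have h2 : U.trunc (r' + 1) = T'.trunc (r' + 1) := h2
  simp only [Set.mem_inter_iff, Set.mem_ofPred_eq, ← h1, ← h2]
  constructor
  · rintro ⟨h3, h4⟩
    rcases le_total r r' with h | h
    · rwa [max_eq_right h]
    · rwa [max_eq_left h]
  · exact fun h => ⟨trunc_mono h (by omega), trunc_mono h (by omega)⟩

theorem closedBall_eq (T : PlanarTree) (r : ℕ) :
    Metric.closedBall T (1 / ((r + 1 : ℕ) : ℝ)) = {T' | T'.trunc (r + 1) = T.trunc (r + 1)} :=
  Set.ext fun _ => mem_closedBall_iff (by omega)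

/-- Two balls are disjoint or nested, so they form a π-system; by second countability it generates
the Borel sets. -/
theorem measure_ext {ν ν' : Measure PlanarTree} [IsProbabilityMeasure ν] [IsProbabilityMeasure ν']
    (h : ∀ (T : PlanarTree) (r : ℕ), ν {T' | T'.trunc (r + 1) = T.trunc (r + 1)} =
      ν' {T' | T'.trunc (r + 1) = T.trunc (r + 1)}) : ν = ν' := by
  refine ext_of_generate_finite _ borel_eq_generateFrom_trunc isPiSystem_trunc ?_ (by simp)
  rintro S ⟨T, r, rfl⟩
  exact h T r

/-! ### Infinite one-sided trees as sequences of branches. -/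

/-- The trees with leftmost path of length at least `n`, in which the first branches are
prescribed by a sequence. -/
def graftAux : ℕ → (ℕ → PlanarTree) → PlanarTree
  | 0, _ => edge
  | n + 1, t => join (graftAux n fun s => t (s + 1)) (t 0)

theorem trunc_graftAux : ∀ (n m : ℕ) (t : ℕ → PlanarTree), n ≤ m →
    (graftAux n t).trunc (n + 1) = (graftAux m t).trunc (n + 1)
  | 0, _, _, _ => trunc_one _ _
  | n + 1, m + 1, t, h => trunc_join_eq_iff.2 ⟨trunc_graftAux n m _ (by omega), rfl⟩

theorem mem_graftAux {n m : ℕ} {t : ℕ → PlanarTree} {v : List ℕ} (hn : v.length ≤ n)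
    (hm : v.length ≤ m) : v ∈ (graftAux n t).verts ↔ v ∈ (graftAux m t).verts := by
  have h1 := trunc_graftAux v.length n t hn
  have h2 := trunc_graftAux v.length m t hm
  exact trunc_eq_iff.1 (h1.symm.trans h2) v (by omega)

/-- The tree with an infinite leftmost path whose branches are prescribed by a sequence. -/
def graft (t : ℕ → PlanarTree) : PlanarTree where
  verts := {v | v ∈ (graftAux v.length t).verts}
  nil_mem := (graftAux 0 t).nil_mem
  root_degree i := root_degree (graftAux 1 t) i
  parent_mem u i h := (mem_graftAux le_rfl (by simp)).2 (parent_mem _ u i h)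
  left_mem u i j h hj := by
    have h : u ++ [i] ∈ (graftAux (u.length + 1) t).verts := by simpa using h
    simpa using left_mem _ u i j h hj
  finite_offspring u := by
    simpa using (graftAux (u.length + 1) t).finite_offspring u

theorem mem_graft_iff {n : ℕ} {t : ℕ → PlanarTree} {v : List ℕ} (hn : v.length ≤ n) :
    v ∈ (graft t).verts ↔ v ∈ (graftAux n t).verts :=
  mem_graftAux (n := v.length) (t := t) le_rfl hn

theorem graft_eq_join (t : ℕ → PlanarTree) :
    graft t = join (graft fun s => t (s + 1)) (t 0) :=
  ext_of_cons fun i w => by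
    rw [mem_graft_iff (n := w.length + 1 + 1) (by simp), graftAux]
    cases i with
    | zero => rw [mem_join_zero, mem_join_zero, mem_graft_iff (n := w.length + 1) (by simp)]
    | succ i => rw [mem_join_succ, mem_join_succ]

theorem branch_graft (s : ℕ) : ∀ t : ℕ → PlanarTree, branch (s + 1) (graft t) = t s := by
  induction s with
  | zero => exact fun t => by rw [graft_eq_join, branch_one_join]
  | succ s ih => exact fun t => by rw [graft_eq_join, branch_add_two, child_join, ih]

theorem measurable_graft : Measurable graft := by
  have h : ∀ n, Measurable (graftAux n) := by
    intro n
    induction n with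
    | zero => exact measurable_const
    | succ n ih =>
      exact measurable_join
        (ih.comp (measurable_pi_lambda _ fun s => measurable_pi_apply (s + 1)))
        (measurable_pi_apply 0)
  refine measurable_of_mem fun i w => ?_
  simp only [mem_graft_iff (n := w.length + 2) (v := _ :: _ :: w) (by simp)]
  exact h (w.length + 2) (measurableSet_mem (0 :: i :: w))

theorem leftWord_mem_graft (k : ℕ) : ∀ t, leftWord k ∈ (graft t).verts := by
  induction k with
  | zero => exact fun t => nil_mem _
  | succ k ih =>
    intro t
    cases k with
    | zero => exact zero_mem _
    | succ k =>
      rw [graft_eq_join]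
      exact mem_join_zero.2 (ih _)

theorem trunc_graft_branch (r : ℕ) : ∀ T : PlanarTree, (∀ k, leftWord k ∈ T.verts) →
    T.trunc r = (graft fun s => branch (s + 1) T).trunc r := by
  induction r with
  | zero => exact fun T _ => trunc_mono (trunc_one _ _) (by omega)
  | succ r ih =>
    intro T hT
    have h1 := eq_join_of_mem (hT 2)
    have h2 : ∀ k, leftWord k ∈ (child T).verts := fun k => by
      match k with
      | 0 => exact nil_mem _
      | 1 => exact zero_mem _
      | k + 2 => exact mem_child.2 (hT (k + 3))
    rw [graft_eq_join]
    conv_lhs => rw [h1]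
    rw [trunc_join_eq_iff]
    refine ⟨(ih _ h2).trans ?_, rfl⟩
    simp only [branch_add_two]

/-- With `branch_graft`, this identifies the trees with infinite leftmost path with arbitrary
sequences of branches. -/
theorem eq_graft {T : PlanarTree} (hT : ∀ k, leftWord k ∈ T.verts) :
    T = graft fun s => branch (s + 1) T := by
  ext v
  exact trunc_eq_iff.1 (trunc_graft_branch v.length T hT) v le_rfl

/-- Levels are finite, so an infinite tree has vertices at arbitrarily large distance; one-sidedness
carries this over to the leftmost path. -/
theorem mem_OmegaInf_iff {T : PlanarTree} : T ∈ OmegaInf ↔ ∀ k, leftWord k ∈ T.verts := by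
  constructor
  · rintro ⟨h1, h2⟩ k
    have h3 : ∃ v ∈ T.verts, k < v.length := by
      by_contra! h
      refine h2 (((Set.finite_le_nat k).biUnion fun s _ => T.finite_level s).subset fun v hv => ?_)
      exact Set.mem_biUnion (show v.length ∈ {i | i ≤ k} from h v hv) ⟨hv, rfl⟩
    obtain ⟨v, hv, hk⟩ := h3
    have h4 : (k : ℕ∞) < ⨆ v ∈ T.leftPath, (v.length : ℕ∞) := by
      rw [h1]
      refine lt_of_lt_of_le (by exact_mod_cast hk)
        (le_iSup₂ (f := fun (v : List ℕ) (_ : v ∈ T.verts) => (v.length : ℕ∞)) v hv)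
    simp only [lt_iSup_iff] at h4
    obtain ⟨_, ⟨hm, m, rfl⟩, hlt⟩ := h4
    have hlt' : k < m := by simpa [leftWord] using hlt
    refine mem_of_append (w := leftWord (m - k)) ?_
    rwa [leftWord, leftWord, List.replicate_append_replicate, Nat.add_sub_cancel' hlt'.le]
  · intro h
    have h1 : (⨆ v ∈ T.leftPath, (v.length : ℕ∞)) = ⊤ := by
      rw [ENat.eq_top_iff_forall_ge]
      intro k
      refine le_trans ?_ (le_iSup₂ (f := fun (v : List ℕ) (_ : v ∈ T.leftPath) =>
        (v.length : ℕ∞)) (leftWord k) ⟨h k, k, rfl⟩)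
      simp [leftWord]
    refine ⟨?_, fun hf => ?_⟩
    · rw [OneSided, h1, eq_comm, eq_top_iff, ← h1]
      exact biSup_mono fun v hv => hv.1
    · exact Set.infinite_range_of_injective (f := leftWord)
        (fun a b hab => by simpa [leftWord] using congrArg List.length hab)
        (hf.subset (by rintro _ ⟨k, rfl⟩; exact h k))

/-- The root edge of `t s` starts at distance `s` from the root, so `r + 1` levels of the whole tree
show `r + 1 - s` levels of `t s`; for `s ≥ r` this is at most its root edge. -/
theorem trunc_graft_eq_iff (r : ℕ) : ∀ t t' : ℕ → PlanarTree,
    (graft t).trunc (r + 1) = (graft t').trunc (r + 1) ↔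
      ∀ s < r, (t s).trunc (r - s + 1) = (t' s).trunc (r - s + 1) := by
  induction r with
  | zero => exact fun t t' => iff_of_true (trunc_one _ _) (by simp)
  | succ r ih =>
    intro t t'
    rw [graft_eq_join t, graft_eq_join t', trunc_join_eq_iff, ih]
    constructor
    · rintro ⟨h1, h2⟩ s hs
      cases s with
      | zero => exact h2
      | succ s => simpa [Nat.add_sub_add_right] using h1 s (by omega)
    · intro h
      refine ⟨fun s hs => ?_, h 0 (by omega)⟩
      simpa [Nat.add_sub_add_right] using h (s + 1) (by omega)

/-! ### Ball probabilities as products over levels. -/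

/-- The product of the offspring probabilities over the first `r` levels below the root. -/
noncomputable def levelProd (p : ℕ → ℝ) (T : PlanarTree) (r : ℕ) : ℝ :=
  ∏ s ∈ Finset.range r, ∏ v ∈ T.level (s + 1), p (T.offspring v)

theorem levelProd_succ (p : ℕ → ℝ) (T : PlanarTree) (r : ℕ) : levelProd p T (r + 1) =
    p (T.offspring [0]) * ∏ s ∈ Finset.range r, ∏ v ∈ T.level (s + 2), p (T.offspring v) := by
  rw [levelProd, Finset.prod_range_succ', level_one, Finset.prod_singleton, mul_comm]

theorem levelProd_edge (p : ℕ → ℝ) (r : ℕ) : levelProd p edge (r + 1) = p 0 := by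
  rw [levelProd_succ, offspring_edge_top]
  simp [level_edge]

/-- The top vertex has one more child in the join than in `B`; for a geometric law this costs the
factor `x`, whatever the number of children. -/
theorem levelProd_join {p : ℕ → ℝ} {x : ℝ} (hp : ∀ n, p (n + 1) = x * p n) (A B : PlanarTree)
    (r : ℕ) : levelProd p (join A B) (r + 1) = x * levelProd p A r * levelProd p B (r + 1) := by
  rw [levelProd_succ, levelProd_succ, offspring_join_top, hp, levelProd]
  simp_rw [prod_level_join]
  rw [Finset.prod_mul_distrib]
  ring

/-- The product of the offspring probabilities of the two-type BGW tree over the first `r` levels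
below the root. -/
noncomputable def twoTypeProd (p : ℕ → ℝ) (T : PlanarTree) (r : ℕ) : ℝ :=
  ∏ s ∈ Finset.range r,
    ((∏ v ∈ (T.level (s + 1)).erase (leftWord (s + 1)), p (T.offspring v)) *
      p (T.offspring (leftWord (s + 1)) - 1))

/-- This holds for every `p`: the special child is not counted in the argument of `p`, so the top
vertex contributes exactly its factor in `B`. -/
theorem twoTypeProd_join (p : ℕ → ℝ) (A B : PlanarTree) (r : ℕ) :
    twoTypeProd p (join A B) (r + 1) = twoTypeProd p A r * levelProd p B (r + 1) := by
  have h0 : ∀ s, (join A B).offspring (leftWord (s + 1 + 1)) = A.offspring (leftWord (s + 1)) :=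
    fun s => offspring_congr fun i => by simp [leftWord, List.replicate_succ]
  have h1 : ((join A B).level (0 + 1)).erase (leftWord (0 + 1)) = ∅ := by
    rw [zero_add, level_one]
    rfl
  have h2 : (join A B).offspring (leftWord (0 + 1)) = B.offspring [0] + 1 :=
    offspring_join_top A B
  rw [twoTypeProd, Finset.prod_range_succ', h1, h2, levelProd_succ, twoTypeProd]
  simp_rw [h0, prod_level_erase_join]
  rw [Finset.prod_empty, one_mul, Nat.add_sub_cancel, mul_left_comm, mul_comm,
    ← Finset.prod_mul_distrib]
  congr 1
  exact Finset.prod_congr rfl fun s _ => by ring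

theorem twoTypeProd_graft (p : ℕ → ℝ) (r : ℕ) : ∀ t : ℕ → PlanarTree,
    twoTypeProd p (graft t) r = ∏ s ∈ Finset.range r, levelProd p (t s) (r - s) := by
  induction r with
  | zero => simp [twoTypeProd]
  | succ r ih =>
    intro t
    rw [graft_eq_join, twoTypeProd_join, ih, Finset.prod_range_succ']
    simp [Nat.add_sub_add_right]

theorem prod_Icc_eq (f : ℕ → ℝ) (r : ℕ) :
    ∏ s ∈ Finset.Icc 1 (r + 1 - 1), f s = ∏ s ∈ Finset.range r, f (s + 1) := by
  rw [Nat.add_sub_cancel, Finset.range_eq_Ico, Finset.prod_Ico_add' f 0 r 1]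
  rfl

theorem isBGW_iff {p : ℕ → ℝ} {ρ : Measure PlanarTree} : IsBGW p ρ ↔ IsProbabilityMeasure ρ ∧
    ∀ (T : PlanarTree) (r : ℕ), ρ {T' | T'.trunc (r + 1) = T.trunc (r + 1)} =
      ENNReal.ofReal (levelProd p T r) := by
  refine and_congr Iff.rfl ⟨fun h T r => ?_, fun h T r hr => ?_⟩
  · rw [← closedBall_eq, h T (r + 1) (by omega), prod_Icc_eq, levelProd]
  · obtain ⟨r, rfl⟩ := Nat.exists_eq_add_of_le' hr
    rw [closedBall_eq, h, prod_Icc_eq, levelProd]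

theorem isTwoTypeBGW_iff {p : ℕ → ℝ} {ν : Measure PlanarTree} : IsTwoTypeBGW p ν ↔
    IsProbabilityMeasure ν ∧ ν OmegaInfᶜ = 0 ∧
    ∀ T ∈ OmegaInf, ∀ r : ℕ, ν {T' | T'.trunc (r + 1) = T.trunc (r + 1)} =
      ENNReal.ofReal (twoTypeProd p T r) := by
  refine and_congr Iff.rfl (and_congr Iff.rfl ⟨fun h T hT r => ?_, fun h T hT r hr => ?_⟩)
  · rw [← closedBall_eq, h T hT (r + 1) (by omega), prod_Icc_eq, twoTypeProd]
  · obtain ⟨r, rfl⟩ := Nat.exists_eq_add_of_le' hr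
    rw [closedBall_eq, h T hT, prod_Icc_eq, twoTypeProd]

end PlanarTree

/-! ### The one-type and two-type BGW measures. -/

namespace PlanarTree

open scoped ENNReal
open FinTree (mass)

/-- The law of the BGW tree with offspring probabilities `x ^ n * (1 - x)`. -/
noncomputable def bgw (x : ℝ) : Measure PlanarTree :=
  Measure.sum fun c : FinTree => ENNReal.ofReal (mass x c) • Measure.dirac c.toTree

open Classical in
theorem bgw_apply (x : ℝ) {S : Set PlanarTree} (hS : MeasurableSet S) :
    bgw x S = ∑' c : FinTree, if c.toTree ∈ S then ENNReal.ofReal (mass x c) else 0 := by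
  rw [bgw, Measure.sum_apply _ hS]
  refine tsum_congr fun c => ?_
  rw [Measure.smul_apply, Measure.dirac_apply' _ hS, smul_eq_mul, Set.indicator_apply]
  split_ifs <;> simp

theorem isProbabilityMeasure_bgw {x : ℝ} (hx0 : 0 < x) (hx : x < 1 / 2) :
    IsProbabilityMeasure (bgw x) := by
  refine ⟨?_⟩
  rw [bgw_apply x MeasurableSet.univ, ← FinTree.tsum_mass hx0 hx]
  simp

theorem measurableSet_trunc (T : PlanarTree) (r : ℕ) :
    MeasurableSet {T' : PlanarTree | T'.trunc (r + 1) = T.trunc (r + 1)} :=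
  (isOpen_setOf_trunc T r).measurableSet

/-- Double induction, on the radius and on the number of children of the top vertex: in `join A B`
the tree `A` is seen with a smaller radius and `B` has one child fewer. Since `T` may be infinite,
induction on its size is not available. -/
theorem bgw_trunc {x : ℝ} (hx0 : 0 < x) (hx : x < 1 / 2) (r : ℕ) : ∀ T : PlanarTree,
    bgw x {T' | T'.trunc (r + 1) = T.trunc (r + 1)} =
      ENNReal.ofReal (levelProd (fun n => x ^ n * (1 - x)) T r) := by
  classical
  have h1x : 0 < 1 - x := by linarith
  have hlp : ∀ T r, 0 ≤ levelProd (fun n => x ^ n * (1 - x)) T r := fun T r =>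
    Finset.prod_nonneg fun _ _ => Finset.prod_nonneg fun _ _ => by positivity
  induction r with
  | zero =>
    intro T
    have h : {T' : PlanarTree | T'.trunc (0 + 1) = T.trunc (0 + 1)} = Set.univ :=
      Set.eq_univ_of_forall fun T' => trunc_one T' T
    have := isProbabilityMeasure_bgw hx0 hx
    rw [h, measure_univ, levelProd, Finset.prod_range_zero, ENNReal.ofReal_one]
  | succ r ih =>
    have key : ∀ (k : ℕ) (T : PlanarTree), T.offspring [0] = k →
        bgw x {T' | T'.trunc (r + 1 + 1) = T.trunc (r + 1 + 1)} =
          ENNReal.ofReal (levelProd (fun n => x ^ n * (1 - x)) T (r + 1)) := by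
      intro k
      induction k with
      | zero =>
        intro T hT
        obtain rfl | ⟨A, B, rfl⟩ := eq_edge_or_join T
        · rw [bgw_apply x (measurableSet_trunc _ _), FinTree.tsum_eq_edge_add,
            if_pos (by exact rfl),
            levelProd_edge, FinTree.mass_edge hx0, pow_zero, one_mul]
          convert add_zero _
          exact ENNReal.tsum_eq_zero.2 fun A => ENNReal.tsum_eq_zero.2 fun B =>
            if_neg trunc_edge_ne_join
        · rw [offspring_join_top] at hT
          omega
      | succ k ihk =>
        intro T hT
        obtain rfl | ⟨A, B, rfl⟩ := eq_edge_or_join T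
        · rw [offspring_edge_top] at hT
          omega
        · rw [offspring_join_top] at hT
          have hA := ih A
          have hB := ihk B (by omega)
          rw [bgw_apply x (measurableSet_trunc _ _)] at hA hB ⊢
          rw [FinTree.tsum_eq_edge_add,
            if_neg (by exact fun h => trunc_edge_ne_join (Eq.symm h)), zero_add,
            levelProd_join (x := x) (fun n => by ring), mul_assoc, ENNReal.ofReal_mul hx0.le,
            ENNReal.ofReal_mul (hlp _ _), ← hA, ← hB, ← FinTree.tsum_tsum_mul,
            ← ENNReal.tsum_mul_left]
          refine tsum_congr fun A' => ?_
          rw [← ENNReal.tsum_mul_left]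
          refine tsum_congr fun B' => ?_
          have h : (FinTree.join A' B').toTree ∈
              {T' | T'.trunc (r + 1 + 1) = (join A B).trunc (r + 1 + 1)} ↔
              A'.toTree ∈ {T' | T'.trunc (r + 1) = A.trunc (r + 1)} ∧
              B'.toTree ∈ {T' | T'.trunc (r + 1 + 1) = B.trunc (r + 1 + 1)} := trunc_join_eq_iff
          by_cases h1 : A'.toTree ∈ {T' | T'.trunc (r + 1) = A.trunc (r + 1)}
          · by_cases h2 : B'.toTree ∈ {T' | T'.trunc (r + 1 + 1) = B.trunc (r + 1 + 1)}
            · rw [if_pos (h.2 ⟨h1, h2⟩), if_pos h1, if_pos h2, FinTree.mass_join hx0,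
                ENNReal.ofReal_mul (by have := FinTree.mass_pos hx0 hx A'; positivity),
                ENNReal.ofReal_mul hx0.le, mul_assoc]
            · rw [if_neg fun h3 => h2 (h.1 h3).2, if_neg h2, mul_zero, mul_zero]
          · rw [if_neg fun h3 => h1 (h.1 h3).1, if_neg h1, zero_mul, mul_zero]
    exact fun T => key _ T rfl

theorem isBGW_bgw {x : ℝ} (hx0 : 0 < x) (hx : x < 1 / 2) :
    IsBGW (fun n => x ^ n * (1 - x)) (bgw x) :=
  isBGW_iff.2 ⟨isProbabilityMeasure_bgw hx0 hx, fun T r => bgw_trunc hx0 hx r T⟩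

theorem isBGW_unique {p : ℕ → ℝ} {ρ ρ' : Measure PlanarTree} (h : IsBGW p ρ) (h' : IsBGW p ρ') :
    ρ = ρ' := by
  rw [isBGW_iff] at h h'
  obtain ⟨_, h⟩ := h
  obtain ⟨_, h'⟩ := h'
  exact measure_ext fun T r => (h T r).trans (h' T r).symm

theorem bgw_singleton (x : ℝ) (c : FinTree) :
    bgw x {c.toTree} = ENNReal.ofReal (mass x c) := by
  classical
  rw [bgw_apply x (measurableSet_singleton _)]
  simp only [Set.mem_singleton_iff, FinTree.toTree_injective.eq_iff]
  rw [tsum_ite_eq]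

theorem ae_isFin_bgw (x : ℝ) : ∀ᵐ T ∂bgw x, T.IsFin := by
  have hm : MeasurableSet {T : PlanarTree | ¬ T.IsFin} := by
    refine MeasurableSet.compl (s := {T : PlanarTree | T.IsFin}) ?_
    rw [← FinTree.range_toTree]
    exact (Set.countable_range _).measurableSet
  rw [ae_iff, bgw_apply x hm]
  exact ENNReal.tsum_eq_zero.2 fun c => if_neg fun h => h (FinTree.isFin_toTree c)

/-- The law of a sequence of independent BGW trees. -/
noncomputable def branchLaw (x : ℝ) : Measure (ℕ → PlanarTree) := Measure.infinitePi fun _ => bgw x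

/-- The law of the tree with an infinite leftmost path and independent BGW branches. -/
noncomputable def spineLaw (x : ℝ) : Measure PlanarTree := (branchLaw x).map graft

theorem isProbabilityMeasure_branchLaw {x : ℝ} (hx0 : 0 < x) (hx : x < 1 / 2) :
    IsProbabilityMeasure (branchLaw x) := by
  have := isProbabilityMeasure_bgw hx0 hx
  unfold branchLaw
  infer_instance

theorem isProbabilityMeasure_spineLaw {x : ℝ} (hx0 : 0 < x) (hx : x < 1 / 2) :
    IsProbabilityMeasure (spineLaw x) := by
  have := isProbabilityMeasure_branchLaw hx0 hx
  exact Measure.isProbabilityMeasure_map measurable_graft.aemeasurable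

theorem ae_isFin_branchLaw {x : ℝ} (hx0 : 0 < x) (hx : x < 1 / 2) :
    ∀ᵐ t ∂branchLaw x, ∀ s, (t s).IsFin := by
  have := isProbabilityMeasure_bgw hx0 hx
  refine ae_all_iff.2 fun s => ?_
  exact (measurePreserving_eval_infinitePi (fun _ => bgw x) s).quasiMeasurePreserving.ae
    (ae_isFin_bgw x)

theorem measurableSet_OmegaInf : MeasurableSet OmegaInf := by
  have : OmegaInf = ⋂ k, {T : PlanarTree | leftWord k ∈ T.verts} := by
    ext T
    rw [mem_OmegaInf_iff, Set.mem_iInter]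
    rfl
  rw [this]
  exact MeasurableSet.iInter fun k => measurableSet_mem _

theorem graft_mem_OmegaInf (t : ℕ → PlanarTree) : graft t ∈ OmegaInf :=
  mem_OmegaInf_iff.2 fun k => leftWord_mem_graft k t

/-- In terms of branches a ball is a product set, so its probability is a product of BGW ball
probabilities with decreasing radii. -/
theorem isTwoTypeBGW_spineLaw {x : ℝ} (hx0 : 0 < x) (hx : x < 1 / 2) :
    IsTwoTypeBGW (fun n => x ^ n * (1 - x)) (spineLaw x) := by
  have h1x : 0 < 1 - x := by linarith
  have := isProbabilityMeasure_bgw hx0 hx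
  refine isTwoTypeBGW_iff.2 ⟨isProbabilityMeasure_spineLaw hx0 hx, ?_, fun T hT r => ?_⟩
  · rw [spineLaw, Measure.map_apply measurable_graft measurableSet_OmegaInf.compl]
    convert measure_empty (μ := branchLaw x)
    exact Set.eq_empty_of_forall_notMem fun t ht => ht (graft_mem_OmegaInf t)
  · rw [spineLaw, Measure.map_apply measurable_graft (measurableSet_trunc T r),
      eq_graft (mem_OmegaInf_iff.1 hT)]
    generalize (fun s => branch (s + 1) T) = t
    have h : graft ⁻¹' {T' | T'.trunc (r + 1) = (graft t).trunc (r + 1)} =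
        Set.pi (Finset.range r) fun s => {T' | T'.trunc (r - s + 1) = (t s).trunc (r - s + 1)} := by
      ext t'
      simp only [Set.mem_preimage, Set.mem_ofPred_eq, trunc_graft_eq_iff, Set.mem_pi,
        Finset.mem_coe, Finset.mem_range]
    rw [h, branchLaw, Measure.infinitePi_pi _ fun s _ => measurableSet_trunc _ _,
      twoTypeProd_graft, ENNReal.ofReal_prod_of_nonneg]
    · exact Finset.prod_congr rfl fun s _ => bgw_trunc hx0 hx _ _
    · exact fun s _ => Finset.prod_nonneg fun _ _ => Finset.prod_nonneg fun _ _ => by positivity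

/-- The formula covers the balls that meet `OmegaInf`, since each such ball has a center in it; all
other balls are null. -/
theorem isTwoTypeBGW_unique {p : ℕ → ℝ} {ν ν' : Measure PlanarTree} (h : IsTwoTypeBGW p ν)
    (h' : IsTwoTypeBGW p ν') : ν = ν' := by
  rw [isTwoTypeBGW_iff] at h h'
  obtain ⟨_, h0, h⟩ := h
  obtain ⟨_, h0', h'⟩ := h'
  refine measure_ext fun T r => ?_
  by_cases hT : ∃ T' ∈ OmegaInf, T'.trunc (r + 1) = T.trunc (r + 1)
  · obtain ⟨T', hT', hr⟩ := hT
    rw [← hr, h T' hT', h' T' hT']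
  · push Not at hT
    have hs : {T' : PlanarTree | T'.trunc (r + 1) = T.trunc (r + 1)} ⊆ OmegaInfᶜ :=
      fun T' h1 h2 => hT T' h2 h1
    rw [measure_mono_null hs h0, measure_mono_null hs h0']

theorem map_branch {x : ℝ} (hx0 : 0 < x) (hx : x < 1 / 2) (s : ℕ) :
    (spineLaw x).map (branch (s + 1)) = bgw x := by
  have := isProbabilityMeasure_bgw hx0 hx
  rw [spineLaw, Measure.map_map (measurable_branch _) measurable_graft]
  have h : branch (s + 1) ∘ graft = fun t => t s := funext fun t => branch_graft s t
  rw [h]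
  exact Measure.infinitePi_map_eval (fun _ => bgw x) s

/-- Taking branches inverts `graft`, so the joint law of the branches is the product measure itself.
-/
theorem iIndepFun_branch {x : ℝ} (hx0 : 0 < x) (hx : x < 1 / 2) :
    ProbabilityTheory.iIndepFun (fun (s : ℕ) (T : PlanarTree) => branch (s + 1) T)
      (spineLaw x) := by
  have := isProbabilityMeasure_spineLaw hx0 hx
  rw [ProbabilityTheory.iIndepFun_iff_map_fun_eq_infinitePi_map fun s => measurable_branch (s + 1)]
  have h : (fun (T : PlanarTree) (s : ℕ) => branch (s + 1) T) ∘ graft = id :=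
    funext fun t => funext fun s => branch_graft s t
  simp_rw [map_branch hx0 hx]
  rw [spineLaw, Measure.map_map (measurable_pi_lambda _ fun s => measurable_branch (s + 1))
    measurable_graft, h, Measure.map_id, branchLaw]

/-! ### The spine and the infinite paths. -/

theorem exists_eq_leftWord_append : ∀ v : List ℕ,
    (∃ k, v = leftWord k) ∨ ∃ s i w, v = leftWord s ++ (i + 1) :: w
  | [] => Or.inl ⟨0, rfl⟩
  | (i + 1) :: w => Or.inr ⟨0, i, w, rfl⟩
  | 0 :: w => by
    rcases exists_eq_leftWord_append w with ⟨k, rfl⟩ | ⟨s, i, w, rfl⟩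
    · exact Or.inl ⟨k + 1, rfl⟩
    · exact Or.inr ⟨s + 1, i, w, rfl⟩

/-- A vertex off the leftmost path leaves it at some `leftWord s` with `s ≥ 1`, and all its
descendants lie in the finite branch grafted there. -/
theorem spine_eq_leftPath {T : PlanarTree} (hT : ∀ k, leftWord k ∈ T.verts)
    (hb : ∀ s, 1 ≤ s → (branch s T).IsFin) : T.spine = T.leftPath := by
  ext v
  constructor
  · rintro ⟨hv, hinf⟩
    refine ⟨hv, ?_⟩
    rcases exists_eq_leftWord_append v with h | ⟨s, i, w, rfl⟩
    · exact h
    · exfalso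
      cases s with
      | zero => exact absurd (head_eq_zero hv) (by omega)
      | succ s =>
        refine hinf ?_
        refine ((hb (s + 1) (by omega)).image fun u => leftWord s ++ shift u).subset ?_
        rintro _ ⟨hu, u, rfl⟩
        have hu' : leftWord (s + 1) ++ (i + 1) :: (w ++ u) ∈ T.verts := by simpa using hu
        refine ⟨0 :: i :: (w ++ u), mem_branch.2 hu', ?_⟩
        simp [shift, leftWord, List.replicate_succ']
  · rintro ⟨hv, k, rfl⟩
    refine ⟨hv, ?_⟩
    refine (Set.infinite_range_of_injective (f := fun n => leftWord (k + n)) ?_).mono ?_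
    · exact fun a b hab => by simpa [leftWord] using congrArg List.length hab
    · rintro _ ⟨n, rfl⟩
      refine ⟨hT _, leftWord n, ?_⟩
      simp only [leftWord, List.replicate_append_replicate]

/-- Every vertex of a ray has infinitely many descendants, hence lies on the spine, where its length
determines it. -/
theorem isRay_iff {T : PlanarTree} (hT : ∀ k, leftWord k ∈ T.verts)
    (hs : T.spine = T.leftPath) (u : ℕ → List ℕ) : T.IsRay u ↔ u = leftWord := by
  constructor
  · rintro ⟨h0, h⟩
    have hlen : ∀ n, (u n).length = n := by
      intro n
      induction n with
      | zero => rw [h0]; rfl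
      | succ n ih =>
        obtain ⟨i, hi⟩ := (h n).2
        rw [hi, List.length_append, ih]
        rfl
    have hpre : ∀ n k, u n <+: u (n + k) := by
      intro n k
      induction k with
      | zero => exact List.prefix_rfl
      | succ k ih =>
        obtain ⟨i, hi⟩ := (h (n + k)).2
        exact ih.trans ⟨[i], hi.symm⟩
    funext n
    have hn : u n ∈ T.spine := by
      refine ⟨(h n).1, (Set.infinite_range_of_injective (f := fun k => u (n + k)) ?_).mono ?_⟩
      · exact fun a b hab => by simpa [hlen] using congrArg List.length hab
      · rintro _ ⟨k, rfl⟩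
        exact ⟨(h _).1, hpre n k⟩
    rw [hs] at hn
    obtain ⟨-, k, hk⟩ := hn
    have := hlen n
    rw [hk] at this ⊢
    simp only [leftWord, List.length_replicate] at this
    rw [this]
  · rintro rfl
    exact ⟨rfl, fun n => ⟨hT n, 0, List.replicate_succ'⟩⟩

theorem ae_spineLaw {x : ℝ} (hx0 : 0 < x) (hx : x < 1 / 2) :
    ∀ᵐ T ∂spineLaw x, T ∈ OmegaInf ∧ T.spine = T.leftPath ∧
      (∀ u : ℕ → List ℕ, T.IsRay u ↔ u = leftWord) ∧ ∀ s : ℕ, 1 ≤ s → (branch s T).IsFin := by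
  have h1 : ∀ᵐ T ∂spineLaw x, T ∈ OmegaInf :=
    (isTwoTypeBGW_spineLaw hx0 hx).2.1
  have h2 : ∀ᵐ T ∂spineLaw x, ∀ s : ℕ, (branch (s + 1) T).IsFin := by
    refine ae_all_iff.2 fun s => ?_
    have := ae_isFin_bgw x
    rw [← map_branch hx0 hx s] at this
    exact ae_of_ae_map (measurable_branch _).aemeasurable this
  filter_upwards [h1, h2] with T hT hb
  rw [mem_OmegaInf_iff] at hT
  have hb' : ∀ s : ℕ, 1 ≤ s → (branch s T).IsFin := fun s hs => by
    obtain ⟨s, rfl⟩ := Nat.exists_eq_add_of_le' hs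
    exact hb s
  have hs := spine_eq_leftPath hT hb'
  exact ⟨mem_OmegaInf_iff.2 hT, hs, isRay_iff hT hs, hb'⟩

end PlanarTree

/-! ### Finite trees with prescribed first branches. -/

namespace FinTree

open scoped ENNReal

/-- The tree with prescribed first branches, in front of which a tree is grafted. -/
def wrap : List FinTree → FinTree → FinTree
  | [], A => A
  | c :: l, A => join (wrap l A) c

/-- The total number of edges of a list of trees. -/
def listSize (l : List FinTree) : ℕ := (l.map size).sum

/-- The sum of the heights of a list of trees. -/
def listHeight (l : List FinTree) : ℕ := (l.map height).sum

/-- The probability that the first branches are given by a list of trees. -/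
noncomputable def listMass (x : ℝ) (l : List FinTree) : ℝ := (l.map (mass x)).prod

theorem size_wrap (A : FinTree) : ∀ l : List FinTree, (wrap l A).size = A.size + listSize l
  | [] => rfl
  | c :: l => by
    have := size_wrap A l
    simp only [wrap, size, this, listSize, List.map_cons, List.sum_cons]
    omega

theorem height_le_wrap (A : FinTree) : ∀ l : List FinTree, A.height ≤ (wrap l A).height
  | [] => le_rfl
  | c :: l => by
    have := height_le_wrap A l
    simp only [wrap, height]
    omega

theorem listMass_nonneg {x : ℝ} (hx0 : 0 < x) (hx : x < 1 / 2) (l : List FinTree) :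
    0 ≤ listMass x l :=
  List.prod_nonneg (by
    intro a ha
    obtain ⟨c, -, rfl⟩ := List.mem_map.1 ha
    exact (mass_pos hx0 hx c).le)

/-- If `A` is higher than all prescribed branches, their height constraints hold automatically. The
sum of the heights is a crude but convenient bound for the maximum. -/
theorem spineMass_wrap {x : ℝ} (hx0 : 0 < x) (A : FinTree) : ∀ l : List FinTree,
    listHeight l < A.height → spineMass x (wrap l A) = spineMass x A * listMass x l
  | [], _ => by simp [wrap, listMass]
  | c :: l, h => by
    simp only [listHeight, List.map_cons, List.sum_cons] at h
    have h1 := height_le_wrap A l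
    rw [wrap, spineMass_join hx0, spineMass_wrap hx0 A l (by rw [listHeight]; omega),
      if_pos (by omega), listMass, listMass, List.map_cons, List.prod_cons]
    ring

theorem wrap_inj {A A' : FinTree} : ∀ {l l' : List FinTree}, l.length = l'.length →
    wrap l A = wrap l' A' → l = l' ∧ A = A'
  | [], [], _, h => ⟨rfl, h⟩
  | c :: l, c' :: l', hl, h => by
    rw [wrap, wrap, join.injEq] at h
    obtain ⟨h1, h2⟩ := wrap_inj (l := l) (l' := l') (by simpa using hl) h.1
    exact ⟨by rw [h1, h.2], h2⟩

/-- The remainder `A` is invisible in this ball: only its root edge is seen, and that is the same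
for all trees. -/
theorem trunc_wrap (A : FinTree) : ∀ (l : List FinTree) (t : ℕ → PlanarTree),
    (∀ i (hi : i < l.length), t i = (l[i]).toTree) →
    (wrap l A).toTree.trunc (l.length + 1) = (PlanarTree.graft t).trunc (l.length + 1)
  | [], _, _ => PlanarTree.trunc_one _ _
  | c :: l, t, h => by
    rw [PlanarTree.graft_eq_join]
    refine PlanarTree.trunc_join_eq_iff.2 ⟨trunc_wrap A l _ fun i hi => ?_, ?_⟩
    · exact h (i + 1) (by simpa using hi)
    · rw [h 0 (by simp)]
      rfl

end FinTree

/-! ### Convergence to the local limit. -/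

namespace PlanarTree

open scoped ENNReal
open FinTree (mass spineMass spineCoeff ofSize oneSidedOfSize wrap listMass listSize listHeight)

-- Multiplying numerator and denominator by `(x(1-x))^N` turns the weights of `τ_N` into `spineMass`
-- over `spineCoeff`; codes that are not one-sided have weight `0`.
open Classical in
theorem tauN_apply {x : ℝ} (hx0 : 0 < x) (hx : x < 1 / 2) (N : ℕ) {S : Set PlanarTree}
    (hS : MeasurableSet S) : tauN (Real.log x) N S = ∑' c : FinTree,
      if c.size = N ∧ c.toTree ∈ S then ENNReal.ofReal (spineMass x c / spineCoeff x N) else 0 := by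
  have hg : (x * (1 - x)) ^ N ≠ 0 := (pow_pos (mul_pos hx0 (by linarith)) N).ne'
  rw [tauN, Measure.sum_apply _ hS, ← (FinTree.equivOmega N).tsum_eq]
  refine (tsum_subtype (oneSidedOfSize N : Set FinTree) fun c => (ENNReal.ofReal
      (Real.exp (-Real.log x * (c.toTree.height.toNat : ℝ)) / partitionFn (Real.log x) N) •
        Measure.dirac c.toTree) S).trans ?_
  refine tsum_congr fun c => ?_
  by_cases hc : c ∈ oneSidedOfSize N
  · rw [Set.indicator_of_mem (by exact hc), Measure.smul_apply, Measure.dirac_apply' _ hS,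
      smul_eq_mul, Set.indicator_apply]
    obtain ⟨h1, h2⟩ := FinTree.mem_oneSidedOfSize.1 hc
    simp only [h1, true_and]
    split_ifs
    · rw [Pi.one_apply, mul_one, ← FinTree.partitionFn_mul hx0, spineMass, if_pos h2, h1,
        mul_div_mul_right _ _ hg, FinTree.height_toTree, ENat.toNat_natCast, neg_mul, Real.exp_neg,
        mul_comm (Real.log x), Real.exp_nat_mul, Real.exp_log hx0]
    · rw [mul_zero]
  · rw [Set.indicator_of_notMem (by exact hc)]
    split_ifs with h
    · have h2 : ¬ c.OneSided := fun h2 => hc (FinTree.mem_oneSidedOfSize.2 ⟨h.1, h2⟩)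
      rw [spineMass, if_neg h2, zero_div, ENNReal.ofReal_zero]
    · rfl

theorem isProbabilityMeasure_tauN {x : ℝ} (hx0 : 0 < x) (hx : x < 1 / 2) {N : ℕ}
    (hN : 0 < spineCoeff x N) : IsProbabilityMeasure (tauN (Real.log x) N) := by
  classical
  refine ⟨?_⟩
  rw [tauN_apply hx0 hx N MeasurableSet.univ, tsum_eq_sum (s := ofSize N)]
  · refine (Finset.sum_congr rfl fun c hc =>
      if_pos ⟨FinTree.mem_ofSize.1 hc, Set.mem_univ _⟩).trans ?_
    rw [← ENNReal.ofReal_sum_of_nonneg, ← Finset.sum_div,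
      ← FinTree.spineCoeff, div_self hN.ne', ENNReal.ofReal_one]
    exact fun c _ => div_nonneg (FinTree.spineMass_nonneg hx0 hx c) hN.le
  · exact fun c hc => if_neg fun h => hc (FinTree.mem_ofSize.2 h.1)

/-- Lists of equal length yield disjoint families of trees in `G`. Only remainders high enough for
`spineMass_wrap` are counted, hence an inequality. -/
theorem sum_le_tauN {x : ℝ} (hx0 : 0 < x) (hx : x < 1 / 2) {N : ℕ} (hN : 0 < spineCoeff x N)
    {G : Set PlanarTree} (hG : MeasurableSet G) {r : ℕ} {s : Finset (List FinTree)}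
    (hr : ∀ l ∈ s, l.length = r) (hs : ∀ l ∈ s, ∀ A, (wrap l A).toTree ∈ G)
    (hsN : ∀ l ∈ s, listSize l ≤ N) :
    ∑ l ∈ s, ENNReal.ofReal (listMass x l * ((∑ c ∈ (ofSize (N - listSize l)).filter
      fun c => listHeight l < c.height, spineMass x c) / spineCoeff x N)) ≤
      tauN (Real.log x) N G := by
  classical
  rw [tauN_apply hx0 hx N hG]
  have hinj : Function.Injective fun p : s × FinTree => wrap p.1 p.2 := by
    rintro ⟨⟨l, hl⟩, A⟩ ⟨⟨l', hl'⟩, A'⟩ h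
    obtain ⟨h1, h2⟩ := FinTree.wrap_inj ((hr l hl).trans (hr l' hl').symm) h
    subst h1 h2
    rfl
  refine le_trans ?_ (ENNReal.tsum_comp_le_tsum_of_injective hinj _)
  rw [ENNReal.tsum_prod', tsum_fintype, ← Finset.sum_coe_sort s]
  refine Finset.sum_le_sum fun l _ => ?_
  obtain ⟨l, hl⟩ := l
  refine le_trans ?_ (ENNReal.sum_le_tsum ((ofSize (N - listSize l)).filter
    fun c => listHeight l < c.height))
  rw [mul_div_assoc', Finset.mul_sum, Finset.sum_div, ENNReal.ofReal_sum_of_nonneg]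
  · refine Finset.sum_le_sum fun c hc => ?_
    obtain ⟨h1, h2⟩ := Finset.mem_filter.1 hc
    rw [FinTree.mem_ofSize] at h1
    have h3 : (wrap l c).size = N := by
      rw [FinTree.size_wrap, h1]
      exact Nat.sub_add_cancel (hsN l hl)
    rw [if_pos ⟨h3, hs l hl c⟩, FinTree.spineMass_wrap hx0 c l h2, mul_comm]
  · exact fun c _ => div_nonneg (mul_nonneg (FinTree.listMass_nonneg hx0 hx l)
      (FinTree.spineMass_nonneg hx0 hx c)) hN.le

/-- Removing a fixed number of edges does not change the limit of the coefficients, so each quotient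
in `sum_le_tauN` tends to `1`. -/
theorem sum_listMass_le_liminf {x : ℝ} (hx0 : 0 < x) (hx : x < 1 / 2)
    {G : Set PlanarTree} (hG : MeasurableSet G) {r : ℕ} {s : Finset (List FinTree)}
    (hr : ∀ l ∈ s, l.length = r) (hs : ∀ l ∈ s, ∀ A, (wrap l A).toTree ∈ G) :
    ∑ l ∈ s, ENNReal.ofReal (listMass x l) ≤
      atTop.liminf fun N => tauN (Real.log x) N G := by
  have hL := FinTree.spineLimit_pos hx0 hx
  have h0 := FinTree.tendsto_spineCoeff hx0 hx
  have h1 : ∀ l : List FinTree, Tendsto (fun N => ENNReal.ofReal (listMass x l *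
      ((∑ c ∈ (ofSize (N - listSize l)).filter fun c => listHeight l < c.height, spineMass x c) /
        spineCoeff x N))) atTop (𝓝 (ENNReal.ofReal (listMass x l))) := by
    intro l
    have h2 := ((FinTree.tendsto_spineCoeff_height hx0 hx (listHeight l)).comp
      (tendsto_sub_atTop_nat (listSize l))).div h0 hL.ne'
    have h3 := h2.const_mul (listMass x l)
    rw [div_self hL.ne', mul_one] at h3
    exact ENNReal.tendsto_ofReal h3
  have h2 := tendsto_finsetSum s fun l _ => h1 l
  rw [← h2.liminf_eq]
  refine liminf_le_liminf ?_
  filter_upwards [h0.eventually (lt_mem_nhds hL), eventually_ge_atTop (s.sup listSize)] with N h3 h4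
  exact sum_le_tauN hx0 hx h3 hG hr hs fun l hl => (Finset.le_sup hl).trans h4

theorem branchLaw_cylinder {x : ℝ} (hx0 : 0 < x) (hx : x < 1 / 2) (l : List FinTree) :
    branchLaw x {t | ∀ i (hi : i < l.length), t i = (l[i]).toTree} =
      ENNReal.ofReal (listMass x l) := by
  have := isProbabilityMeasure_bgw hx0 hx
  have h : {t : ℕ → PlanarTree | ∀ i (hi : i < l.length), t i = (l[i]).toTree} =
      Set.pi (Finset.range l.length) fun i => {(l.getD i .edge).toTree} := by
    ext t
    simp only [Set.mem_ofPred_eq, Set.mem_pi, Finset.mem_coe, Finset.mem_range,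
      Set.mem_singleton_iff]
    refine forall_congr' fun i => forall_congr' fun hi => ?_
    rw [List.getD_eq_getElem _ _ hi]
  rw [h, branchLaw, Measure.infinitePi_pi _ fun s _ => measurableSet_singleton _]
  simp_rw [bgw_singleton]
  rw [← ENNReal.ofReal_prod_of_nonneg fun i _ => (FinTree.mass_pos hx0 hx _).le]
  congr 1
  clear h
  induction l with
  | nil => simp [listMass]
  | cons c l ih =>
    rw [List.length_cons, Finset.prod_range_succ']
    simp only [List.getD_cons_succ, List.getD_cons_zero, listMass, List.map_cons, List.prod_cons]
    rw [ih, mul_comm]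
    rfl

/-- `G` is exhausted, up to a null set, by events that depend on finitely many finite branches.
There are countably many such choices, and finite families of them suffice for a lower bound. -/
theorem spineLaw_le_liminf {x : ℝ} (hx0 : 0 < x) (hx : x < 1 / 2) {G : Set PlanarTree}
    (hG : IsOpen G) : spineLaw x G ≤ atTop.liminf fun N => tauN (Real.log x) N G := by
  rw [spineLaw, Measure.map_apply measurable_graft hG.measurableSet]
  set U : ℕ → Set (ℕ → PlanarTree) := fun r =>
    {t | (∀ s, (t s).IsFin) ∧ {T' | T'.trunc (r + 1) = (graft t).trunc (r + 1)} ⊆ G}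
  have hU : Monotone U := fun r r' hr t ht =>
    ⟨ht.1, fun T' hT' => ht.2 (trunc_mono hT' (by omega))⟩
  have h1 : branchLaw x (graft ⁻¹' G) ≤ branchLaw x (⋃ r, U r) := by
    refine measure_mono_ae ?_
    filter_upwards [ae_isFin_branchLaw hx0 hx] with t ht htG
    obtain ⟨r, hr⟩ := exists_trunc_subset hG htG
    exact Set.mem_iUnion.2 ⟨r, ht, hr⟩
  refine h1.trans ?_
  rw [hU.measure_iUnion]
  refine iSup_le fun r => ?_
  -- By `trunc_wrap`, the first `r` branches of any element of `U r` form such a list.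
  set Λ : Set (List FinTree) := {l | l.length = r ∧ ∀ A, (wrap l A).toTree ∈ G}
  have h2 : U r ⊆ ⋃ l ∈ Λ, {t | ∀ i (hi : i < l.length), t i = (l[i]).toTree} := by
    rintro t ⟨ht, hr⟩
    choose c hc using fun s => FinTree.range_toTree.ge (ht s)
    have h3 : ∀ i (hi : i < (List.ofFn fun i : Fin r => c i).length),
        t i = ((List.ofFn fun i : Fin r => c i)[i]).toTree := fun i hi => by
      rw [List.getElem_ofFn, hc]
    refine Set.mem_biUnion ⟨List.length_ofFn, fun A => hr ?_⟩ h3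
    have h4 := FinTree.trunc_wrap A _ t h3
    rwa [List.length_ofFn] at h4
  refine (measure_mono h2).trans ((measure_biUnion_le _ (Set.to_countable Λ) _).trans ?_)
  simp_rw [branchLaw_cylinder hx0 hx]
  rw [ENNReal.tsum_eq_iSup_sum]
  refine iSup_le fun s => ?_
  have h5 := sum_listMass_le_liminf hx0 hx hG.measurableSet (r := r)
    (s := s.map (Function.Embedding.subtype _))
    (fun l hl => by
      obtain ⟨l, -, rfl⟩ := Finset.mem_map.1 hl
      exact l.2.1)
    (fun l hl => by
      obtain ⟨l, -, rfl⟩ := Finset.mem_map.1 hl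
      exact l.2.2)
  rwa [Finset.sum_map] at h5

theorem isLocalLimit_spineLaw {x : ℝ} (hx0 : 0 < x) (hx : x < 1 / 2) :
    IsLocalLimit (Real.log x) (spineLaw x) := by
  have hP := isProbabilityMeasure_spineLaw hx0 hx
  refine ⟨hP, fun F => ?_⟩
  -- For small `N` the measure `τ_N` need not be a probability measure: `Ω_0` is empty. The sequence
  -- is therefore shifted by `N₀`.
  obtain ⟨N₀, hN₀⟩ := eventually_atTop.1 ((FinTree.tendsto_spineCoeff hx0 hx).eventually
    (lt_mem_nhds (FinTree.spineLimit_pos hx0 hx)))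
  let τ : ℕ → ProbabilityMeasure PlanarTree := fun N => ⟨tauN (Real.log x) (N + N₀),
    isProbabilityMeasure_tauN hx0 hx (hN₀ _ (by omega))⟩
  have h : Tendsto τ atTop (𝓝 (⟨spineLaw x, hP⟩ : ProbabilityMeasure PlanarTree)) := by
    refine tendsto_of_forall_isOpen_le_liminf' fun G hG => ?_
    refine (spineLaw_le_liminf hx0 hx hG).trans (le_of_eq ?_)
    exact (liminf_nat_add (fun N => tauN (Real.log x) N G) N₀).symm
  have h2 := ProbabilityMeasure.tendsto_iff_forall_integral_tendsto.1 h F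
  exact (tendsto_add_atTop_iff_nat N₀).1 h2

theorem isLocalLimit_unique {μ : ℝ} {τ τ' : Measure PlanarTree} (h : IsLocalLimit μ τ)
    (h' : IsLocalLimit μ τ') : τ = τ' := by
  have := h.1
  have := h'.1
  exact ext_of_forall_integral_eq_of_IsFiniteMeasure fun F =>
    tendsto_nhds_unique (h.2 F) (h'.2 F)

theorem isSubcriticalLaw_geometric {x : ℝ} (hx0 : 0 < x) (hx : x < 1 / 2) :
    IsSubcriticalLaw fun n => x ^ n * (1 - x) := by
  have h1x : 0 < 1 - x := by linarith
  refine ⟨fun n => by positivity, ?_, x / (1 - x) ^ 2 * (1 - x), ?_, ?_⟩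
  · have := (hasSum_geometric_of_lt_one hx0.le (by linarith)).mul_right (1 - x)
    rwa [inv_mul_cancel₀ h1x.ne'] at this
  · have := (hasSum_coe_mul_geometric_of_norm_lt_one (r := x)
      (by rw [Real.norm_of_nonneg hx0.le]; linarith)).mul_right (1 - x)
    simpa only [mul_assoc] using this
  · rw [pow_two, ← div_div, div_mul_cancel₀ _ h1x.ne', div_lt_one h1x]
    linarith

end PlanarTree

theorem mainTheorem6 (μ : ℝ) (hμ : μ < -Real.log 2) (p : ℕ → ℝ)
    (hp : ∀ n : ℕ, p n = Real.exp (μ * n) * (1 - Real.exp μ)) :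
    -- the offspring probabilities
    (∀ n : ℕ, p n =
      PlanarTree.genX (PlanarTree.gCrit μ) ^ n * (1 - PlanarTree.genX (PlanarTree.gCrit μ))) ∧
    PlanarTree.IsSubcriticalLaw p ∧
    -- `τ` is the local limit, and `ρ` is the BGW tree
    ∃ τ ρ : MeasureTheory.Measure PlanarTree,
      (∀ τ' : MeasureTheory.Measure PlanarTree, PlanarTree.IsLocalLimit μ τ' ↔ τ' = τ) ∧
      (∀ ρ' : MeasureTheory.Measure PlanarTree, PlanarTree.IsBGW p ρ' ↔ ρ' = ρ) ∧
      -- `τ` is the two-type BGW measure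
      (∀ ν : MeasureTheory.Measure PlanarTree, PlanarTree.IsTwoTypeBGW p ν ↔ ν = τ) ∧
      -- the leftmost path is almost surely the single spine, and the branches are finite
      (∀ᵐ T ∂τ, T ∈ PlanarTree.OmegaInf ∧ T.spine = T.leftPath ∧
        (∀ u : ℕ → List ℕ, T.IsRay u ↔ u = PlanarTree.leftWord) ∧
        ∀ s : ℕ, 1 ≤ s → (PlanarTree.branch s T).IsFin) ∧
      -- the branches are independent and distributed according to `ρ`
      ProbabilityTheory.iIndepFun (fun (s : ℕ) (T : PlanarTree) => PlanarTree.branch (s + 1) T) τ ∧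
      ∀ s : ℕ, 1 ≤ s → MeasureTheory.Measure.map (PlanarTree.branch s) τ = ρ := by
  obtain ⟨x, hx0, rfl⟩ : ∃ x : ℝ, 0 < x ∧ Real.log x = μ :=
    ⟨Real.exp μ, Real.exp_pos μ, Real.log_exp μ⟩
  have hx : x < 1 / 2 := by
    rwa [← Real.log_inv, Real.log_lt_log_iff hx0 (by norm_num), ← one_div] at hμ
  obtain rfl : p = fun n => x ^ n * (1 - x) := by
    funext n
    rw [hp, mul_comm (Real.log x), Real.exp_nat_mul, Real.exp_log hx0]
  refine ⟨fun n => ?_, PlanarTree.isSubcriticalLaw_geometric hx0 hx, PlanarTree.spineLaw x,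
    PlanarTree.bgw x, fun τ' => ⟨fun h => ?_, ?_⟩, fun ρ' => ⟨fun h => ?_, ?_⟩,
    fun ν => ⟨fun h => ?_, ?_⟩, PlanarTree.ae_spineLaw hx0 hx,
    PlanarTree.iIndepFun_branch hx0 hx, fun s hs => ?_⟩
  · rw [FinTree.gCrit_log hx0 hx, FinTree.genX_eq hx0 hx]
  · exact PlanarTree.isLocalLimit_unique h (PlanarTree.isLocalLimit_spineLaw hx0 hx)
  · rintro rfl
    exact PlanarTree.isLocalLimit_spineLaw hx0 hx
  · exact PlanarTree.isBGW_unique h (PlanarTree.isBGW_bgw hx0 hx)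
  · rintro rfl
    exact PlanarTree.isBGW_bgw hx0 hx
  · exact PlanarTree.isTwoTypeBGW_unique h (PlanarTree.isTwoTypeBGW_spineLaw hx0 hx)
  · rintro rfl
    exact PlanarTree.isTwoTypeBGW_spineLaw hx0 hx
  · obtain ⟨s, rfl⟩ := Nat.exists_eq_add_of_le' hs
    exact PlanarTree.map_branch hx0 hx s
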